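/- Let $m,n\ge 1$ and let $\Theta$ be an $m\times m$ matrix with holomorphic coefficients near the origin in $\mathbb{C}^n$, of generic rank $m$ (that is, $\det\Theta\not\equiv 0$ in every neighbourhood of $0$). Let $X$ be a complex manifold, and let $c$ (with values in $\mathbb{C}^n$) and $b$ (with values in $\mathbb{C}^m$) be holomorphic maps defined on an open neighbourhood of $\{0\}\times X$ in $\mathbb{C}^n\times X$. Assume that $$c(0,\omega)=0,\qquad \det c_z(0,\omega)\neq 0\qquad\text{for every }\omega\in X,$$ where $c_z$ is the Jacobian matrix of $c$ with respect to $z\in\mathbb{C}^n$. Then there exists a holomorphic map $\Gamma=\Gamma(z,\omega)$ with values in $\mathbb{C}^m$, defined on an open neighbourhood $W$ of $\{0\}\times X$ in $\mathbb{C}^n\times X$, such that, if $u\colon(\mathbb{C}^n,0)\to\mathbb{C}^m$ is a germ of a holomorphic map satisfying $\Theta(c(z,\omega_0))\cdot u(z)=b(z,\omega_0)$ for some $\omega_0\in X$ (as germs at $z=0$), then $u(z)=\Gamma(z,\omega_0)$ as germs at $z=0$. Furthermore, $\Gamma$ and $W$ can be chosen such that the following holds. Write the Taylor expansions at $z=0$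 $$b(z,\omega)=\sum_{\alpha\in\mathbb{N}^n}b_\alpha(\omega)z^\alpha,\qquad c(z,\omega)=\sum_{\alpha\in\mathbb{N}^n}c_\alpha(\omega)z^\alpha ,$$ and for $l\in\mathbb{N}$ let $J_0^l(\mathbb{C}^n,\mathbb{C}^k)$ be the space of $l$-jets at $0$ of holomorphic maps from $\mathbb{C}^n$ to $\mathbb{C}^k$, with the Taylor coefficients of order at most $l$ as coordinates. Then there exist an integer $\ell_0\ge 0$ and, for every $\alpha\in\mathbb{N}^n$, a nonnegative integer $k_\alpha$ and a polynomial mapping $$p_\alpha\colon J_0^{\ell_0+|\alpha|}(\mathbb{C}^n,\mathbb{C}^m)\times J_0^{\ell_0+|\alpha|}(\mathbb{C}^n,\mathbb{C}^n)\to\mathbb{C}^m$$ such that for all $(z,\omega)\in W$ $$\Gamma(z,\omega)=\sum_{\alpha\in\mathbb{N}^n}\frac{p_\alpha\big((b_\beta(\omega),c_\beta(\omega))_{|\beta|\le \ell_0+|\alpha|}\big)}{(\det c_z(0,\omega))^{k_\alpha}}\,z^\alpha ,$$ the series being (unconditionally) convergent. -/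

import Mathlib

open Filter
open scoped Topology Manifold ContDiff

noncomputable section

/-- A matrix-valued function `Θ` defined near `0 ∈ ℂⁿ` (holomorphic in all uses below) has generic
rank `r` at `0` if `r` is the maximal rank of `Θ z` in small neighbourhoods of `0`: the rank is at
most `r` near `0`, and the value `r` is attained at points arbitrarily close to `0`. -/
def HasGenericRank {n k l : ℕ} (Θ : (Fin n → ℂ) → Matrix (Fin k) (Fin l) ℂ) (r : ℕ) : Prop :=
  (∀ᶠ z in 𝓝 0, (Θ z).rank ≤ r) ∧ ∃ᶠ z in 𝓝 0, (Θ z).rank = r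

/-- The partial derivative `∂f/∂zᵢ` of a function of `n` complex variables. -/
def partialDeriv {n : ℕ} {F : Type*} [NormedAddCommGroup F] [NormedSpace ℂ F]
    (i : Fin n) (f : (Fin n → ℂ) → F) : (Fin n → ℂ) → F :=
  fun z => fderiv ℂ f z (Pi.single i 1)

/-- The iterated partial derivative `∂^α f = ∂₀^{α₀} ∂₁^{α₁} ⋯ ∂ₙ₋₁^{αₙ₋₁} f`. -/
def iteratedPartialDeriv {n : ℕ} {F : Type*} [NormedAddCommGroup F] [NormedSpace ℂ F]
    (α : Fin n → ℕ) (f : (Fin n → ℂ) → F) : (Fin n → ℂ) → F :=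
  (List.finRange n).foldr (fun i g => (partialDeriv i)^[α i] g) f

/-- The Taylor coefficient `f_α = ∂^α f (0) / α!`, so that `f z = ∑ f_α z^α` near `0` for
holomorphic `f`. -/
def taylorCoeff {n : ℕ} {F : Type*} [NormedAddCommGroup F] [NormedSpace ℂ F]
    (α : Fin n → ℕ) (f : (Fin n → ℂ) → F) : F :=
  (∏ i, (Nat.factorial (α i) : ℂ))⁻¹ • iteratedPartialDeriv α f 0

/-- The coordinates on `J₀ᴺ(ℂⁿ, ℂᵐ) × J₀ᴺ(ℂⁿ, ℂⁿ)`: the variable `(β, inl i)` stands for the `i`-th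
component of the coefficient of `z^β` in the first jet, `(β, inr j)` for the `j`-th component of the
coefficient of `z^β` in the second jet, where `|β| ≤ N`. -/
abbrev JetVar (n m N : ℕ) : Type :=
  {β : Fin n → ℕ // ∑ i, β i ≤ N} × (Fin m ⊕ Fin n)

/-- The coordinates of the pair of `N`-jets at `0` of `f : ℂⁿ → ℂᵐ` and `g : ℂⁿ → ℂⁿ`. -/
def jetCoords {n m : ℕ} (N : ℕ) (f : (Fin n → ℂ) → (Fin m → ℂ)) (g : (Fin n → ℂ) → (Fin n → ℂ)) :
    JetVar n m N → ℂ
  | (β, Sum.inl i) => taylorCoeff β.1 f i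
  | (β, Sum.inr j) => taylorCoeff β.1 g j

end

/-! Multiplying Θ(c)u = b by the adjugate of Θ(c) gives Δ(c(z,ω)) u(z) = f(z,ω) with Δ = det Θ ≢ 0
and f = adj Θ(c)·b, so each component of u is a scalar quotient. What is needed is a formula for the
Taylor coefficients of this quotient that makes sense, and converges, for every ω, including those
for which the division fails.

Let d be the order of Δ at 0 and w a vector at which its leading form P does not vanish
(`exists_homogeneousValue_ne_zero`). Put v = c_z(0,ω)⁻¹w and substitute z = ζ(v + σ). Since c(ζ(v +
σ),ω) = ζ(w + ...), with dots vanishing at ζ = σ = 0, Δ∘c becomes ζ^d G with G(0) = P(w), a nonzero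
number independent of ω (`coeff_zero_denominatorSeries`). Hence f(ζ(v + σ))/G is always holomorphic.
If a solution u exists, this quotient is ζ^d u(ζ(v + σ)), and its coefficient at ζ^(d+|α|) σ^α is
exactly u_α (`coeff_taylorSeries_comp_rayMap`). For arbitrary ω the same coefficient is taken as the
definition (`quotientCoeff`), and Γ is the resulting series.

Convergence, jointly with local coordinates on X, holds because extracting these coefficients turns
a polydisc of radius r ≤ 1 into one of radius r² (`HasMvSeries.summable_diagonalSeries`).
Polynomiality is a weight count: along the ray, the coefficients of ζ-degree k involve only jets of
order at most k + 1, the inverse Jacobian determinant enters only through v, and inverting G divides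
only by P(w) (`coeff_taylorSeries_comp_mem`, `coeff_mul_inv_mem`). Removing ζ^d from the denominator
and reading off ζ-degree d + |α| gives the order 2d + 1 + |α|. -/

/-! ### Absolutely convergent power series in several variables and analyticity. -/

noncomputable section MultiIndexSeries

variable {ι : Type*} [Fintype ι]

/-- `f` is the sum of the power series `a` on the closed polydisc of radius `r`, on which the
series converges absolutely. -/
structure HasMvSeries (a : MvPowerSeries ι ℂ) (f : (ι → ℂ) → ℂ) (r : ℝ) : Prop where
  pos : 0 < r
  summable : Summable fun μ : ι →₀ ℕ => ‖MvPowerSeries.coeff μ a‖ * r ^ μ.degree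
  hasSum : ∀ z : ι → ℂ, (∀ i, ‖z i‖ ≤ r) →
    HasSum (fun μ : ι →₀ ℕ => MvPowerSeries.coeff μ a * ∏ i, z i ^ μ i) (f z)

/-- `f` is the sum of the power series `a` near the origin. -/
def RepresentedBy (f : (ι → ℂ) → ℂ) (a : MvPowerSeries ι ℂ) : Prop :=
  ∃ r, HasMvSeries a f r

theorem norm_monomial_le {z : ι → ℂ} {r : ℝ} (hz : ∀ i, ‖z i‖ ≤ r) (μ : ι →₀ ℕ) :
    ‖∏ i, z i ^ μ i‖ ≤ r ^ μ.degree := by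
  rw [norm_prod, Finsupp.degree_eq_sum, ← Finset.prod_pow_eq_pow_sum]
  refine Finset.prod_le_prod (fun i _ => norm_nonneg _) fun i _ => ?_
  rw [norm_pow]
  exact pow_le_pow_left₀ (norm_nonneg _) (hz i) _

theorem eventually_polydisc {r : ℝ} (hr : 0 < r) : ∀ᶠ z : ι → ℂ in 𝓝 0, ∀ i, ‖z i‖ ≤ r := by
  filter_upwards [Metric.closedBall_mem_nhds (0 : ι → ℂ) hr] with z hz i
  exact (norm_le_pi_norm z i).trans (by simpa using hz)

namespace HasMvSeries

variable {a b : MvPowerSeries ι ℂ} {f g : (ι → ℂ) → ℂ} {r : ℝ}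

theorem mono (h : HasMvSeries a f r) {s : ℝ} (hs : 0 < s) (hsr : s ≤ r) : HasMvSeries a f s := by
  refine ⟨hs, h.summable.of_nonneg_of_le (fun μ => by positivity) fun μ => ?_,
    fun z hz => h.hasSum z fun i => (hz i).trans hsr⟩
  gcongr

/-- Absolutely summable coefficients define a function on a polydisc. -/
theorem of_summable (hr : 0 < r)
    (h : Summable fun μ : ι →₀ ℕ => ‖MvPowerSeries.coeff μ a‖ * r ^ μ.degree) :
    HasMvSeries a (fun z => ∑' μ : ι →₀ ℕ, MvPowerSeries.coeff μ a * ∏ i, z i ^ μ i) r := by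
  refine ⟨hr, h, fun z hz => Summable.hasSum (Summable.of_norm_bounded h fun μ => ?_)⟩
  rw [norm_mul]
  gcongr
  exact norm_monomial_le hz μ

theorem congr (h : HasMvSeries a f r) (hfg : ∀ z : ι → ℂ, (∀ i, ‖z i‖ ≤ r) → f z = g z) :
    HasMvSeries a g r :=
  ⟨h.pos, h.summable, fun z hz => hfg z hz ▸ h.hasSum z hz⟩

theorem apply_zero (h : HasMvSeries a f r) : f 0 = MvPowerSeries.coeff 0 a := by
  have h0 := h.hasSum 0 (by simp [h.pos.le])
  refine h0.unique ?_
  convert! hasSum_single (f := fun μ : ι →₀ ℕ =>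
    MvPowerSeries.coeff μ a * ∏ i, (0 : ι → ℂ) i ^ μ i) 0 ?_ using 1
  · simp
  · intro μ hμ
    obtain ⟨i, hi⟩ := Finsupp.ne_iff.1 hμ
    rw [Finset.prod_eq_zero (Finset.mem_univ i), mul_zero]
    simpa using hi

theorem add (hf : HasMvSeries a f r) (hg : HasMvSeries b g r) :
    HasMvSeries (a + b) (fun z => f z + g z) r := by
  refine ⟨hf.pos, (hf.summable.add hg.summable).of_nonneg_of_le
    (fun μ => mul_nonneg (norm_nonneg _) (pow_nonneg hf.pos.le _)) fun μ => ?_, fun z hz => ?_⟩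
  · rw [map_add, ← add_mul]
    exact mul_le_mul_of_nonneg_right (norm_add_le _ _) (pow_nonneg hf.pos.le _)
  · simpa only [map_add, add_mul] using (hf.hasSum z hz).add (hg.hasSum z hz)

theorem mul (hf : HasMvSeries a f r) (hg : HasMvSeries b g r) :
    HasMvSeries (a * b) (fun z => f z * g z) r := by
  classical
  have key : ∀ μ : ι →₀ ℕ, ‖MvPowerSeries.coeff μ (a * b)‖ * r ^ μ.degree ≤
      ∑ p ∈ Finset.HasAntidiagonal.antidiagonal μ, (‖MvPowerSeries.coeff p.1 a‖ * r ^ p.1.degree) *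
        (‖MvPowerSeries.coeff p.2 b‖ * r ^ p.2.degree) := by
    intro μ
    rw [MvPowerSeries.coeff_mul]
    refine (mul_le_mul_of_nonneg_right (norm_sum_le _ _) (pow_nonneg hf.pos.le _)).trans ?_
    rw [Finset.sum_mul]
    refine Finset.sum_le_sum fun p hp => le_of_eq ?_
    rw [← Finset.HasAntidiagonal.mem_antidiagonal.1 hp, map_add, pow_add, norm_mul]
    ring
  refine ⟨hf.pos, ?_, fun z hz => ?_⟩
  · refine Summable.of_nonneg_of_le (fun μ => by have := hf.pos; positivity) key ?_
    have hnn : ∀ (d : MvPowerSeries ι ℂ),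
        0 ≤ fun μ : ι →₀ ℕ => ‖MvPowerSeries.coeff μ d‖ * r ^ μ.degree :=
      fun d μ => mul_nonneg (norm_nonneg _) (pow_nonneg hf.pos.le _)
    have hm := hf.summable.mul_of_nonneg hg.summable (hnn a) (hnn b)
    exact summable_sum_mul_antidiagonal_of_summable_mul
      (f := fun μ : ι →₀ ℕ => ‖MvPowerSeries.coeff μ a‖ * r ^ μ.degree)
      (g := fun μ : ι →₀ ℕ => ‖MvPowerSeries.coeff μ b‖ * r ^ μ.degree) hm
  · have hfz := hf.hasSum z hz
    have hgz := hg.hasSum z hz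
    generalize hF : (fun μ : ι →₀ ℕ => MvPowerSeries.coeff μ a * ∏ i, z i ^ μ i) = F at hfz
    generalize hG : (fun μ : ι →₀ ℕ => MvPowerSeries.coeff μ b * ∏ i, z i ^ μ i) = G at hgz
    have hs := summable_mul_of_summable_norm hfz.summable.norm hgz.summable.norm
    have h1 := summable_sum_mul_antidiagonal_of_summable_mul (f := F) (g := G) hs
    have h2 := hfz.summable.tsum_mul_tsum_eq_tsum_sum_antidiagonal hgz.summable hs
    rw [hfz.tsum_eq, hgz.tsum_eq] at h2
    rw [h2]
    convert! h1.hasSum using 2 with μ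
    rw [MvPowerSeries.coeff_mul, Finset.sum_mul, ← hF, ← hG]
    refine Finset.sum_congr rfl fun p hp => ?_
    rw [← Finset.HasAntidiagonal.mem_antidiagonal.1 hp]
    simp only [Finsupp.add_apply, pow_add, Finset.prod_mul_distrib]
    ring

end HasMvSeries

/-- Peeling off one variable at a time writes a monomial as a word in the coordinates, hence as the
diagonal value of a multilinear map. -/
theorem exists_monomial_multilinear (k : ℕ) : ∀ μ : ι →₀ ℕ, μ.degree = k →
    ∃ s : Fin k → ι, ∀ z : ι → ℂ, ∏ t, z (s t) = ∏ i, z i ^ μ i := by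
  classical
  induction k with
  | zero =>
    intro μ hμ
    rw [Finsupp.degree_eq_zero_iff] at hμ
    exact ⟨Fin.elim0, fun z => by simp [hμ]⟩
  | succ k ih =>
    intro μ hμ
    have hne : μ ≠ 0 := by
      rintro rfl
      simp at hμ
    obtain ⟨i, hi⟩ := Finsupp.ne_iff.1 hne
    have hle : Finsupp.single i 1 ≤ μ := by
      rw [Finsupp.single_le_iff]
      exact Nat.one_le_iff_ne_zero.2 hi
    obtain ⟨s, hs⟩ := ih (μ - Finsupp.single i 1) (by
      have := congrArg Finsupp.degree (tsub_add_cancel_of_le hle)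
      rw [map_add, Finsupp.degree_single] at this
      omega)
    refine ⟨Fin.cons i s, fun z => ?_⟩
    rw [Fin.prod_univ_succ]
    simp only [Fin.cons_zero, Fin.cons_succ]
    rw [hs]
    conv_rhs => rw [← tsub_add_cancel_of_le hle]
    simp only [Finsupp.add_apply, pow_add, Finset.prod_mul_distrib]
    rw [mul_comm]
    congr 1
    rw [Finset.prod_eq_single i] <;> simp +contextual [eq_comm]

theorem exists_monomialCMM (μ : ι →₀ ℕ) :
    ∃ M : ContinuousMultilinearMap ℂ (fun _ : Fin μ.degree => ι → ℂ) ℂ,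
      ‖M‖ ≤ 1 ∧ ∀ z : ι → ℂ, M (fun _ => z) = ∏ i, z i ^ μ i := by
  obtain ⟨s, hs⟩ := exists_monomial_multilinear μ.degree μ rfl
  refine ⟨(ContinuousMultilinearMap.mkPiAlgebra ℂ (Fin μ.degree) ℂ).compContinuousLinearMap
    fun t => ContinuousLinearMap.proj (s t), ?_, fun z => ?_⟩
  · refine (ContinuousMultilinearMap.norm_compContinuousLinearMap_le _ _).trans ?_
    rw [ContinuousMultilinearMap.norm_mkPiAlgebra, one_mul]
    refine Finset.prod_le_one (fun _ _ => norm_nonneg _) fun t _ => ?_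
    refine ContinuousLinearMap.opNorm_le_bound _ zero_le_one fun z => ?_
    simpa using norm_le_pi_norm z (s t)
  · simp [hs]

theorem sum_degree_fiber {A : Type*} [NormedAddCommGroup A]  (F : (ι →₀ ℕ) → A) (k : ℕ) :
    ∑' μ : (Finsupp.degree ⁻¹' {k} : Set (ι →₀ ℕ)), F μ
      = ∑ μ ∈ (Finsupp.finite_of_degree_eq (σ := ι) k).toFinset, F μ := by
  rw [← Finset.tsum_subtype']
  have : (Finsupp.degree ⁻¹' {k} : Set (ι →₀ ℕ))
      = ((Finsupp.finite_of_degree_eq (σ := ι) k).toFinset : Set (ι →₀ ℕ)) := by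
    ext μ; simp
  rw [this]

theorem HasMvSeries.analyticAt {a : MvPowerSeries ι ℂ} {f : (ι → ℂ) → ℂ} {r : ℝ}
    (h : HasMvSeries a f r) : AnalyticAt ℂ f 0 := by
  -- The arity `k` is kept independent of `μ`, with a dummy zero map when the degrees differ, so
  -- that monomials of one degree can be added without casts.
  have hM : ∀ (k : ℕ) (μ : ι →₀ ℕ), ∃ M : ContinuousMultilinearMap ℂ (fun _ : Fin k => ι → ℂ) ℂ,
      ‖M‖ ≤ 1 ∧ (μ.degree = k → ∀ z : ι → ℂ, M (fun _ => z) = ∏ i, z i ^ μ i) := by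
    intro k μ
    by_cases hk : μ.degree = k
    · subst hk
      obtain ⟨M, h1, h2⟩ := exists_monomialCMM μ
      exact ⟨M, h1, fun _ => h2⟩
    · exact ⟨0, by simp, fun h => absurd h hk⟩
  choose M hM1 hM2 using hM
  set S : ℕ → Finset (ι →₀ ℕ) := fun k => (Finsupp.finite_of_degree_eq (σ := ι) k).toFinset
  have hS : ∀ k μ, μ ∈ S k ↔ μ.degree = k := by simp [S]
  let p : FormalMultilinearSeries ℂ (ι → ℂ) ℂ := fun k =>
    ∑ μ ∈ S k, MvPowerSeries.coeff μ a • M k μ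
  have hp : HasFPowerSeriesOnBall f p 0 (ENNReal.ofReal r) := by
    refine ⟨?_, by simpa using h.pos, fun {y} hy => ?_⟩
    · have hr : ENNReal.ofReal r = ((NNReal.mk r h.pos.le : NNReal) : ENNReal) := by
        rw [ENNReal.ofReal_eq_coe_nnreal h.pos.le]
      rw [hr]
      refine p.le_radius_of_bound (∑' μ : ι →₀ ℕ, ‖MvPowerSeries.coeff μ a‖ * r ^ μ.degree)
        fun k => ?_
      refine le_trans ?_ (h.summable.sum_le_tsum (S k)
        fun μ _ => mul_nonneg (norm_nonneg _) (pow_nonneg h.pos.le _))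
      refine (mul_le_mul_of_nonneg_right (norm_sum_le _ _) (pow_nonneg h.pos.le _)).trans ?_
      rw [Finset.sum_mul]
      refine Finset.sum_le_sum fun μ hμ => ?_
      rw [(hS k μ).1 hμ]
      refine mul_le_mul_of_nonneg_right ?_ (pow_nonneg h.pos.le _)
      rw [norm_smul]
      exact mul_le_of_le_one_right (norm_nonneg _) (hM1 _ _)
    · have hy' : ∀ i, ‖y i‖ ≤ r := fun i => (norm_le_pi_norm y i).trans <| by
        have : ‖y‖ < r := by
          rw [Metric.mem_eball, edist_zero_right, ← ofReal_norm] at hy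
          exact (ENNReal.ofReal_lt_ofReal_iff h.pos).1 hy
        exact this.le
      have h1 := (h.hasSum y hy').tsum_fiberwise Finsupp.degree
      rw [zero_add]
      convert! h1 using 2 with k
      rw [sum_degree_fiber (F := fun μ => MvPowerSeries.coeff μ a * ∏ i, y i ^ μ i)]
      simp only [p, sum_apply, smul_apply]
      refine Finset.sum_congr rfl fun μ hμ => ?_
      rw [hM2 k μ ((hS k μ).1 hμ), smul_eq_mul]
  exact hp.analyticAt

theorem RepresentedBy.analyticAt {a : MvPowerSeries ι ℂ} {f : (ι → ℂ) → ℂ}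
    (h : RepresentedBy f a) : AnalyticAt ℂ f 0 :=
  h.choose_spec.analyticAt

/-- Each p_k(z,…,z) is expanded over the words of length k in the basis vectors. Words with the same
letters give the same monomial, and summing over each such class yields the coefficients. -/
theorem AnalyticAt.exists_representedBy {f : (ι → ℂ) → ℂ} (h : AnalyticAt ℂ f 0) :
    ∃ a, RepresentedBy f a := by
  classical
  obtain ⟨p, R, hp⟩ := h
  obtain ⟨R', hR'0, hR'⟩ := ENNReal.lt_iff_exists_nnreal_btwn.1 hp.r_pos
  have hR'0 : 0 < R' := by exact_mod_cast hR'0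
  -- There are (card ι)^k words of length k, so the radius shrinks by about card ι; the added 1
  -- keeps the divisor positive when `ι` is empty.
  set N : NNReal := Fintype.card ι + 1
  have hN : 0 < N := by positivity
  set ρ : NNReal := R' / N
  have hρ0 : 0 < ρ := div_pos hR'0 hN
  have hNρ : N * ρ = R' := mul_div_cancel₀ _ hN.ne'
  have hρR : ρ ≤ R' := div_le_self R'.2 (by simp [N])
  let T := Σ k : ℕ, (Fin k → ι)
  let c : T → ℂ := fun τ => p τ.1 fun t => Pi.single (τ.2 t) 1
  let content : T → (ι →₀ ℕ) := fun τ => ∑ t, Finsupp.single (τ.2 t) 1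
  have hdeg : ∀ τ, (content τ).degree = τ.1 := fun τ => by simp [content]
  have hmon : ∀ (z : ι → ℂ) (τ : T), ∏ i, z i ^ content τ i = ∏ t, z (τ.2 t) := by
    rintro z ⟨k, s⟩
    simp only [content, Finsupp.finsetSum_apply]
    simp_rw [← Finset.prod_pow_eq_pow_sum]
    rw [Finset.prod_comm]
    refine Finset.prod_congr rfl fun t _ => ?_
    rw [Finset.prod_eq_single (s t)] <;> simp +contextual
  have hsum : Summable fun τ : T => ‖c τ‖ * (ρ : ℝ) ^ τ.1 := by
    rw [summable_sigma_of_nonneg (fun τ => by positivity)]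
    refine ⟨fun k => Summable.of_finite, ?_⟩
    have hb := p.summable_norm_mul_pow (hR'.trans_le hp.r_le)
    refine hb.of_nonneg_of_le (fun k => tsum_nonneg fun s => by positivity) fun k => ?_
    rw [tsum_fintype]
    calc ∑ s : Fin k → ι, ‖c ⟨k, s⟩‖ * (ρ : ℝ) ^ k
        ≤ ∑ s : Fin k → ι, ‖p k‖ * (ρ : ℝ) ^ k := by
          refine Finset.sum_le_sum fun s _ => ?_
          gcongr
          refine ((p k).le_opNorm _).trans ?_
          refine mul_le_of_le_one_right (norm_nonneg _) ?_
          refine Finset.prod_le_one (fun _ _ => norm_nonneg _) fun t _ => ?_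
          refine (pi_norm_le_iff_of_nonneg zero_le_one).2 fun i => ?_
          by_cases hi : i = s t
          · subst hi; simp
          · simp [hi]
      _ = ‖p k‖ * ((Fintype.card ι : ℝ) * ρ) ^ k := by
          simp [mul_pow]; ring
      _ ≤ ‖p k‖ * (R' : ℝ) ^ k := by
          have : (Fintype.card ι : ℝ) * ρ ≤ R' := by
            rw [← hNρ]; push_cast [N]; nlinarith [ρ.2]
          gcongr
  let a : MvPowerSeries ι ℂ := fun μ => ∑' τ : (content ⁻¹' {μ} : Set T), c τ
  have ha : ∀ μ, MvPowerSeries.coeff μ a = ∑' τ : (content ⁻¹' {μ} : Set T), c τ := fun μ => rfl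
  have hcs : ∀ μ : ι →₀ ℕ, Summable fun τ : (content ⁻¹' {μ} : Set T) => ‖c τ‖ := by
    intro μ
    have h1 := hsum.subtype (content ⁻¹' {μ})
    have h2 : ((fun τ : T => ‖c τ‖ * (ρ : ℝ) ^ τ.1) ∘ Subtype.val
        : (content ⁻¹' {μ} : Set T) → ℝ) = fun τ => ‖c τ.1‖ * (ρ : ℝ) ^ μ.degree := by
      funext τ
      have : content τ = μ := τ.2
      simp [← hdeg, this]
    replace h1 := h2 ▸ h1
    exact (summable_mul_right_iff (pow_pos (by exact_mod_cast hρ0) _).ne').1 h1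
  refine ⟨a, ρ, by exact_mod_cast hρ0, ?_, fun z hz => ?_⟩
  · have h1 := (hsum.hasSum.tsum_fiberwise content).summable
    refine h1.of_nonneg_of_le (fun μ => by positivity) fun μ => ?_
    rw [ha]
    refine (mul_le_mul_of_nonneg_right (norm_tsum_le_tsum_norm (hcs μ)) (by positivity)).trans ?_
    rw [← tsum_mul_right]
    refine le_of_eq (tsum_congr fun τ => ?_)
    have : content τ = μ := τ.2
    simp [← hdeg, this]
  · have hz1 : ∀ τ : T, ‖c τ * ∏ t, z (τ.2 t)‖ ≤ ‖c τ‖ * (ρ : ℝ) ^ τ.1 := by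
      intro τ
      rw [norm_mul, ← hmon, ← hdeg]
      gcongr
      exact norm_monomial_le hz _
    have hs1 : Summable fun τ : T => c τ * ∏ t, z (τ.2 t) := Summable.of_norm_bounded hsum hz1
    have hz2 : z ∈ Metric.eball (0 : ι → ℂ) R := by
      rw [Metric.mem_eball, edist_zero_right]
      refine lt_of_le_of_lt ?_ hR'
      rw [enorm_eq_nnnorm]
      have : ‖z‖ ≤ ρ := (pi_norm_le_iff_of_nonneg ρ.2).2 hz
      exact_mod_cast this.trans (by exact_mod_cast hρR)
    have hpz : ∀ k, p k (fun _ => z) = ∑ s : Fin k → ι, c ⟨k, s⟩ * ∏ t, z (s t) := by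
      intro k
      have hz3 : z = ∑ i, z i • (Pi.single i 1 : ι → ℂ) := by
        conv_lhs => rw [← Finset.univ_sum_single z]
        refine Finset.sum_congr rfl fun i _ => ?_
        rw [← Pi.single_smul, smul_eq_mul, mul_one]
      conv_lhs => rw [hz3]
      rw [ContinuousMultilinearMap.map_sum]
      refine Finset.sum_congr rfl fun s _ => ?_
      rw [ContinuousMultilinearMap.map_smul_univ, smul_eq_mul, mul_comm]
    have h1 := hp.hasSum hz2
    rw [zero_add] at h1
    have h2 : HasSum (fun τ : T => c τ * ∏ t, z (τ.2 t)) (f z) := by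
      have h3 := hs1.hasSum.sigma (g := fun k => p k fun _ => z) fun k => by
        rw [hpz]; exact hasSum_fintype _
      rw [h1.unique h3]
      exact hs1.hasSum
    convert! h2.tsum_fiberwise content using 2 with μ
    rw [ha, ← tsum_mul_right]
    refine tsum_congr fun τ => ?_
    have : content τ = μ := τ.2
    rw [← hmon, this]

end MultiIndexSeries

/-! ### Termwise differentiation, uniqueness of coefficients, the chain rule for Taylor series. -/

noncomputable section MultiIndexDeriv

theorem exists_add_single {ι : Type*} {μ : ι →₀ ℕ} {i : ι} (h : μ i ≠ 0) :
    ∃ ν, μ = ν + Finsupp.single i 1 :=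
  ⟨μ - Finsupp.single i 1, (tsub_add_cancel_of_le (by
    rw [Finsupp.single_le_iff]; exact Nat.one_le_iff_ne_zero.2 h)).symm⟩

variable {ι : Type*} [Fintype ι]

namespace HasMvSeries

variable {a : MvPowerSeries ι ℂ} {f : (ι → ℂ) → ℂ} {r : ℝ}

/-- The factor μ_i + 1 ≤ 2^|μ| produced by differentiation is absorbed by halving the radius. -/
theorem norm_coeff_pderiv_le {ι : Type*} {a : MvPowerSeries ι ℂ} {r : ℝ} (hr : 0 < r) (i : ι) (μ : ι →₀ ℕ) :
    ‖MvPowerSeries.coeff μ (MvPowerSeries.pderiv ℂ i a)‖ * (r / 2) ^ μ.degree ≤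
      ‖MvPowerSeries.coeff (μ + Finsupp.single i 1) a‖ * r ^ (μ + Finsupp.single i 1).degree
        * r⁻¹ := by
  rw [MvPowerSeries.coeff_pderiv, map_add, Finsupp.degree_single, norm_mul, pow_succ, div_pow]
  have h1 : ‖((μ i : ℂ) + 1)‖ ≤ 2 ^ μ.degree := by
    have : (μ i) + 1 ≤ 2 ^ μ.degree :=
      (Nat.lt_two_pow_self).trans_le (Nat.pow_le_pow_right (by norm_num) (Finsupp.le_degree i μ))
    rw [← Nat.cast_succ, Complex.norm_natCast]
    exact_mod_cast this
  have h2 : ‖MvPowerSeries.coeff (μ + Finsupp.single i 1) a‖ * ‖((μ i : ℂ) + 1)‖ *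
      (r ^ μ.degree / 2 ^ μ.degree) ≤ ‖MvPowerSeries.coeff (μ + Finsupp.single i 1) a‖ *
        2 ^ μ.degree * (r ^ μ.degree / 2 ^ μ.degree) := by gcongr
  refine h2.trans (le_of_eq ?_)
  field_simp

theorem summable_pderiv (h : HasMvSeries a f r) (i : ι) :
    Summable fun μ : ι →₀ ℕ =>
      ‖MvPowerSeries.coeff μ (MvPowerSeries.pderiv ℂ i a)‖ * (r / 2) ^ μ.degree := by
  have h1 := (h.summable.comp_injective (add_left_injective (Finsupp.single i 1))).mul_right r⁻¹
  exact h1.of_nonneg_of_le (fun μ => by have := h.pos; positivity)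
    fun μ => norm_coeff_pderiv_le h.pos i μ

end HasMvSeries

namespace RepresentedBy

variable {a b : MvPowerSeries ι ℂ} {f g : (ι → ℂ) → ℂ}

theorem congr (h : RepresentedBy f a) (hfg : f =ᶠ[𝓝 0] g) : RepresentedBy g a := by
  obtain ⟨r, hr⟩ := h
  obtain ⟨ε, hε, hball⟩ := Metric.eventually_nhds_iff_ball.1 hfg
  refine ⟨min r (ε / 2), (hr.mono (lt_min hr.pos (by positivity)) (min_le_left _ _)).congr
    fun z hz => hball z ?_⟩
  rw [mem_ball_zero_iff]
  refine lt_of_le_of_lt ((pi_norm_le_iff_of_nonneg (by positivity)).2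
    fun i => (hz i).trans (min_le_right _ _)) (by linarith)

theorem eventuallyEq (h : RepresentedBy f a) (h' : RepresentedBy g a) : f =ᶠ[𝓝 0] g := by
  obtain ⟨r, hr⟩ := h
  obtain ⟨s, hs⟩ := h'
  filter_upwards [eventually_polydisc hr.pos, eventually_polydisc hs.pos] with z h1 h2
  exact (hr.hasSum z h1).unique (hs.hasSum z h2)

theorem add (h : RepresentedBy f a) (h' : RepresentedBy g b) :
    RepresentedBy (fun z => f z + g z) (a + b) := by
  obtain ⟨r, hr⟩ := h
  obtain ⟨s, hs⟩ := h'
  have := lt_min hr.pos hs.pos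
  exact ⟨min r s, (hr.mono this (min_le_left _ _)).add (hs.mono this (min_le_right _ _))⟩

theorem mul (h : RepresentedBy f a) (h' : RepresentedBy g b) :
    RepresentedBy (fun z => f z * g z) (a * b) := by
  obtain ⟨r, hr⟩ := h
  obtain ⟨s, hs⟩ := h'
  have := lt_min hr.pos hs.pos
  exact ⟨min r s, (hr.mono this (min_le_left _ _)).mul (hs.mono this (min_le_right _ _))⟩

theorem apply_zero (h : RepresentedBy f a) : f 0 = MvPowerSeries.coeff 0 a :=
  h.choose_spec.apply_zero

end RepresentedBy

theorem representedBy_zero : RepresentedBy (fun _ : ι → ℂ => 0) 0 :=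
  ⟨1, one_pos, by simp, fun z _ => by simp⟩

theorem representedBy_const (w : ℂ) :
    RepresentedBy (fun _ : ι → ℂ => w) (MvPowerSeries.C w) := by
  have hz : ∀ μ : ι →₀ ℕ, μ ∉ ({0} : Finset (ι →₀ ℕ)) →
      MvPowerSeries.coeff μ (MvPowerSeries.C w : MvPowerSeries ι ℂ) = 0 := fun μ hμ =>
    MvPowerSeries.coeff_C_of_ne_zero (by simpa using hμ) w
  refine ⟨1, one_pos, summable_of_ne_finset_zero (s := {0}) fun μ hμ => by simp [hz μ hμ],
    fun z _ => ?_⟩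
  simpa using hasSum_sum_of_ne_finset_zero (L := SummationFilter.unconditional _)
    (s := {(0 : ι →₀ ℕ)}) (f := fun μ => MvPowerSeries.coeff μ (MvPowerSeries.C w : MvPowerSeries ι ℂ) *
      ∏ i, z i ^ μ i) fun μ hμ => by rw [hz μ hμ, zero_mul]

theorem representedBy_coord (i : ι) :
    RepresentedBy (fun z : ι → ℂ => z i) (MvPowerSeries.X i) := by
  classical
  have hz : ∀ μ : ι →₀ ℕ, μ ∉ ({Finsupp.single i 1} : Finset (ι →₀ ℕ)) →
      MvPowerSeries.coeff μ (MvPowerSeries.X i : MvPowerSeries ι ℂ) = 0 := fun μ hμ => by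
    rw [MvPowerSeries.coeff_X, if_neg (by simpa using hμ)]
  refine ⟨1, one_pos, summable_of_ne_finset_zero (s := {Finsupp.single i 1})
    fun μ hμ => by simp [hz μ hμ], fun z _ => ?_⟩
  have h1 := hasSum_sum_of_ne_finset_zero (L := SummationFilter.unconditional _)
    (s := {Finsupp.single i 1}) (f := fun μ => MvPowerSeries.coeff μ (MvPowerSeries.X i : MvPowerSeries ι ℂ) *
      ∏ i, z i ^ μ i) fun μ hμ => by rw [hz μ hμ, zero_mul]
  rw [Finset.sum_singleton, MvPowerSeries.coeff_X, if_pos rfl, one_mul,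
    Finset.prod_eq_single i (fun k _ hk => by rw [Finsupp.single_eq_of_ne hk, pow_zero])
      (fun h => absurd (Finset.mem_univ i) h), Finsupp.single_eq_same, pow_one] at h1
  exact h1

theorem analyticAt_coord (i : ι) (w : ι → ℂ) : AnalyticAt ℂ (fun z : ι → ℂ => z i) w :=
  (ContinuousLinearMap.proj (R := ℂ) (φ := fun _ : ι => ℂ) i).analyticAt w

section Derivative

variable [DecidableEq ι]

/-- The partial derivative in the `i`-th coordinate direction. -/
def coordDeriv (i : ι) (f : (ι → ℂ) → ℂ) : (ι → ℂ) → ℂ :=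
  fun z => fderiv ℂ f z (Pi.single i 1)

theorem prod_update_pow (z : ι → ℂ) (i : ι) (t : ℂ) (μ : ι →₀ ℕ) :
    ∏ k, Function.update z i t k ^ μ k = t ^ μ i * ∏ k ∈ Finset.univ.erase i, z k ^ μ k := by
  rw [← Finset.mul_prod_erase _ _ (Finset.mem_univ i), Function.update_self]
  congr 1
  refine Finset.prod_congr rfl fun k hk => ?_
  rw [Function.update_of_ne (Finset.ne_of_mem_erase hk)]

/-- Differentiating in one variable with the others frozen suffices: the total derivative exists by
analyticity, and this computes its value on a basis vector. -/
theorem HasMvSeries.hasDerivAt {a : MvPowerSeries ι ℂ} {f : (ι → ℂ) → ℂ} {r : ℝ} (h : HasMvSeries a f r) (i : ι) {z : ι → ℂ} (hz : ∀ k, ‖z k‖ < r / 2) :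
    HasDerivAt (fun t => f (Function.update z i t))
      (∑' μ : ι →₀ ℕ, MvPowerSeries.coeff μ (MvPowerSeries.pderiv ℂ i a) * ∏ k, z k ^ μ k)
      (z i) := by
  have hr := h.pos
  let g : (ι →₀ ℕ) → ℂ → ℂ := fun μ t =>
    MvPowerSeries.coeff μ a * ∏ k, Function.update z i t k ^ μ k
  let g' : (ι →₀ ℕ) → ℂ → ℂ := fun μ t => MvPowerSeries.coeff μ a *
    (μ i * t ^ (μ i - 1) * ∏ k ∈ Finset.univ.erase i, z k ^ μ k)
  have hg'0 : ∀ μ t, μ i = 0 → g' μ t = 0 := fun μ t hμ => by simp [g', hμ]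
  have hg'1 : ∀ (ν : ι →₀ ℕ) t, g' (ν + Finsupp.single i 1) t =
      MvPowerSeries.coeff ν (MvPowerSeries.pderiv ℂ i a) *
        ∏ k, Function.update z i t k ^ ν k := by
    intro ν t
    rw [prod_update_pow, MvPowerSeries.coeff_pderiv]
    have : ∏ k ∈ Finset.univ.erase i, z k ^ (ν + Finsupp.single i 1 : ι →₀ ℕ) k =
        ∏ k ∈ Finset.univ.erase i, z k ^ ν k := by
      refine Finset.prod_congr rfl fun k hk => ?_
      rw [Finsupp.add_apply, Finsupp.single_eq_of_ne (Finset.ne_of_mem_erase hk), add_zero]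
    simp only [g', this]
    simp
    ring
  have hdec : ∀ μ : ι →₀ ℕ, μ i ≠ 0 → ∃ ν, μ = ν + Finsupp.single i 1 := fun μ hμ =>
    ⟨μ - Finsupp.single i 1, (tsub_add_cancel_of_le (by
      rw [Finsupp.single_le_iff]; exact Nat.one_le_iff_ne_zero.2 hμ)).symm⟩
  have hupd : ∀ t : ℂ, ‖t‖ < r / 2 → ∀ k, ‖Function.update z i t k‖ ≤ r / 2 := by
    intro t ht k
    by_cases hk : k = i
    · subst hk; simpa using ht.le
    · rw [Function.update_of_ne hk]; exact (hz k).le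
  have hmem : z i ∈ Metric.ball (0 : ℂ) (r / 2) := by simpa using hz i
  have key := hasDerivAt_tsum_of_isPreconnected (g := g) (g' := g')
    (u := fun μ => ‖MvPowerSeries.coeff μ a‖ * r ^ μ.degree * r⁻¹) (t := Metric.ball 0 (r / 2))
    (h.summable.mul_right _) Metric.isOpen_ball (convex_ball _ _).isPreconnected
    (fun μ t _ => by
      simp only [g, g', prod_update_pow]
      exact ((hasDerivAt_pow (μ i) t).mul_const _).const_mul _)
    (fun μ t ht => by
      by_cases hμ : μ i = 0
      · rw [hg'0 _ _ hμ, norm_zero]; positivity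
      · obtain ⟨ν, rfl⟩ := hdec μ hμ
        rw [hg'1, norm_mul]
        refine le_trans ?_ (HasMvSeries.norm_coeff_pderiv_le hr i ν)
        gcongr
        exact norm_monomial_le (hupd t (by simpa using ht)) ν)
    hmem
    (by
      simp only [g, Function.update_eq_self]
      exact (h.hasSum z fun k => (hz k).le.trans (by linarith)).summable) hmem
  have hval : ∑' μ, g' μ (z i) = ∑' μ : ι →₀ ℕ,
      MvPowerSeries.coeff μ (MvPowerSeries.pderiv ℂ i a) * ∏ k, z k ^ μ k := by
    rw [← (add_left_injective (Finsupp.single i 1)).tsum_eq (f := fun μ => g' μ (z i))]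
    · refine tsum_congr fun ν => ?_
      rw [hg'1, Function.update_eq_self]
    · intro μ hμ
      by_cases h0 : μ i = 0
      · exact absurd (hg'0 μ _ h0) hμ
      · obtain ⟨ν, rfl⟩ := hdec μ h0
        exact ⟨ν, rfl⟩
  rw [hval] at key
  refine key.congr_of_eventuallyEq ?_
  filter_upwards [Metric.isOpen_ball.mem_nhds hmem] with t ht
  exact ((h.hasSum _ fun k => (hupd t (by simpa using ht) k).trans (by linarith)).tsum_eq).symm

theorem RepresentedBy.pderiv {a : MvPowerSeries ι ℂ} {f : (ι → ℂ) → ℂ} (h : RepresentedBy f a) (i : ι) :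
    RepresentedBy (coordDeriv i f) (MvPowerSeries.pderiv ℂ i a) := by
  have han := h.analyticAt
  obtain ⟨r, hr⟩ := h
  have h1 : RepresentedBy _ (MvPowerSeries.pderiv ℂ i a) :=
    ⟨r / 2, HasMvSeries.of_summable (half_pos hr.pos) (hr.summable_pderiv i)⟩
  refine h1.congr ?_
  filter_upwards [eventually_polydisc (show 0 < r / 4 by linarith [hr.pos]),
    han.eventually_analyticAt] with z hz hfz
  have h2 := hr.hasDerivAt i (z := z) fun k => (hz k).trans_lt (by linarith [hr.pos])
  have h3 : HasDerivAt (fun t => f (Function.update z i t)) (coordDeriv i f z) (z i) := by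
    have h4 : HasFDerivAt f (fderiv ℂ f z) (Function.update z i (z i)) := by
      rw [Function.update_eq_self]
      exact hfz.differentiableAt.hasFDerivAt
    exact h4.comp_hasDerivAt (z i) (hasDerivAt_update z i (z i))
  exact h2.unique h3

end Derivative

/-- The constant term is the value at 0, and a coefficient of degree k + 1 is a nonzero multiple of
a degree k coefficient of a partial derivative, so induction on the degree applies to all functions
at once. -/
theorem RepresentedBy.unique {f : (ι → ℂ) → ℂ} {a b : MvPowerSeries ι ℂ} (ha : RepresentedBy f a) (hb : RepresentedBy f b) : a = b := by
  classical
  suffices H : ∀ (k : ℕ) (f : (ι → ℂ) → ℂ) (a b : MvPowerSeries ι ℂ), RepresentedBy f a →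
      RepresentedBy f b → ∀ μ : ι →₀ ℕ, μ.degree = k →
        MvPowerSeries.coeff μ a = MvPowerSeries.coeff μ b by
    ext μ
    exact H _ f a b ha hb μ rfl
  intro k
  induction k with
  | zero =>
    intro f a b ha hb μ hμ
    rw [Finsupp.degree_eq_zero_iff] at hμ
    rw [hμ, ← ha.apply_zero, ← hb.apply_zero]
  | succ k ih =>
    intro f a b ha hb μ hμ
    have hne : μ ≠ 0 := by rintro rfl; simp at hμ
    obtain ⟨i, hi⟩ := Finsupp.ne_iff.1 hne
    have hle : Finsupp.single i 1 ≤ μ := by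
      rw [Finsupp.single_le_iff]; exact Nat.one_le_iff_ne_zero.2 hi
    have hμ' := tsub_add_cancel_of_le hle
    have h1 := ih _ _ _ (ha.pderiv i) (hb.pderiv i) (μ - Finsupp.single i 1) (by
      have := congrArg Finsupp.degree hμ'
      rw [map_add, Finsupp.degree_single] at this
      omega)
    rw [MvPowerSeries.coeff_pderiv, MvPowerSeries.coeff_pderiv, hμ'] at h1
    refine mul_right_cancel₀ ?_ h1
    exact Nat.cast_add_one_ne_zero _

/-- The Taylor series at the origin of a function of several complex variables, with value `0` for
functions that are not analytic at the origin. -/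
def taylorSeries (f : (ι → ℂ) → ℂ) : MvPowerSeries ι ℂ :=
  open Classical in if h : ∃ a, RepresentedBy f a then h.choose else 0

theorem AnalyticAt.representedBy {f : (ι → ℂ) → ℂ} (h : AnalyticAt ℂ f 0) :
    RepresentedBy f (taylorSeries f) := by
  rw [taylorSeries, dif_pos h.exists_representedBy]
  exact h.exists_representedBy.choose_spec

theorem RepresentedBy.taylorSeries_eq {f : (ι → ℂ) → ℂ} {a : MvPowerSeries ι ℂ}
    (h : RepresentedBy f a) : taylorSeries f = a :=
  h.analyticAt.representedBy.unique h

variable {f g : (ι → ℂ) → ℂ}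

theorem taylorSeries_congr (hf : AnalyticAt ℂ f 0) (h : f =ᶠ[𝓝 0] g) :
    taylorSeries f = taylorSeries g :=
  ((hf.representedBy.congr h).taylorSeries_eq).symm

theorem taylorSeries_mul (hf : AnalyticAt ℂ f 0) (hg : AnalyticAt ℂ g 0) :
    taylorSeries (fun z => f z * g z) = taylorSeries f * taylorSeries g :=
  (hf.representedBy.mul hg.representedBy).taylorSeries_eq

theorem coeff_zero_taylorSeries (hf : AnalyticAt ℂ f 0) :
    MvPowerSeries.coeff 0 (taylorSeries f) = f 0 :=
  hf.representedBy.apply_zero.symm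

theorem taylorSeries_sum {κ : Type*} (s : Finset κ) (F : κ → (ι → ℂ) → ℂ)
    (hF : ∀ k, AnalyticAt ℂ (F k) 0) :
    taylorSeries (fun z => ∑ k ∈ s, F k z) = ∑ k ∈ s, taylorSeries (F k) := by
  classical
  refine RepresentedBy.taylorSeries_eq ?_
  induction s using Finset.induction_on with
  | empty => simpa using representedBy_zero
  | insert k s hk ih =>
    simp only [Finset.sum_insert hk]
    exact (hF k).representedBy.add ih

variable [DecidableEq ι]

theorem AnalyticAt.coordDeriv (hf : AnalyticAt ℂ f 0) (i : ι) :
    AnalyticAt ℂ (coordDeriv i f) 0 :=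
  (hf.representedBy.pderiv i).analyticAt

theorem taylorSeries_coordDeriv (hf : AnalyticAt ℂ f 0) (i : ι) :
    taylorSeries (coordDeriv i f) = MvPowerSeries.pderiv ℂ i (taylorSeries f) :=
  (hf.representedBy.pderiv i).taylorSeries_eq

/-- Chain rule for the Taylor series of a composition. -/
theorem pderiv_taylorSeries_comp {κ : Type*} [Fintype κ] [DecidableEq κ] {θ : (κ → ℂ) → ℂ}
    {C : (ι → ℂ) → (κ → ℂ)} (hC : ∀ j, AnalyticAt ℂ (fun z => C z j) 0) (hC0 : C 0 = 0)
    (hθ : AnalyticAt ℂ θ 0) (i : ι) :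
    MvPowerSeries.pderiv ℂ i (taylorSeries fun z => θ (C z)) =
      ∑ j, taylorSeries (fun z => coordDeriv j θ (C z)) *
        MvPowerSeries.pderiv ℂ i (taylorSeries fun z => C z j) := by
  have hCa : AnalyticAt ℂ C 0 := by
    rw [analyticAt_pi_iff]; exact hC
  have hcomp : ∀ {η : (κ → ℂ) → ℂ}, AnalyticAt ℂ η 0 → AnalyticAt ℂ (fun z => η (C z)) 0 :=
    fun {η} hη => AnalyticAt.fun_comp (by rwa [hC0]) hCa
  rw [← taylorSeries_coordDeriv (hcomp hθ)]
  simp_rw [← taylorSeries_coordDeriv (hC _), ← taylorSeries_mul (hcomp (hθ.coordDeriv _))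
    ((hC _).coordDeriv i)]
  rw [← taylorSeries_sum Finset.univ
    (fun j z => coordDeriv j θ (C z) * coordDeriv i (fun z => C z j) z)
    fun j => (hcomp (hθ.coordDeriv j)).mul ((hC j).coordDeriv i)]
  refine taylorSeries_congr ((hcomp hθ).coordDeriv i) ?_
  have hθ' : ∀ᶠ z in 𝓝 (0 : ι → ℂ), AnalyticAt ℂ θ (C z) := by
    refine hCa.continuousAt.eventually ?_
    rw [hC0]
    exact hθ.eventually_analyticAt
  filter_upwards [hCa.eventually_analyticAt, hθ'] with z hz1 hz2
  have h1 : fderiv ℂ (fun z => θ (C z)) z = (fderiv ℂ θ (C z)).comp (fderiv ℂ C z) :=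
    fderiv_comp z hz2.differentiableAt hz1.differentiableAt
  simp only [coordDeriv, h1, ContinuousLinearMap.comp_apply]
  set w := fderiv ℂ C z (Pi.single i 1)
  have hw : ∀ j, fderiv ℂ (fun z => C z j) z (Pi.single i 1) = w j := by
    intro j
    have := (hasFDerivAt_pi'.1 hz1.differentiableAt.hasFDerivAt j).fderiv
    rw [this]
    rfl
  simp_rw [hw]
  conv_lhs => rw [← Finset.univ_sum_single w, map_sum]
  refine Finset.sum_congr rfl fun j _ => ?_
  rw [show Pi.single j (w j) = w j • (Pi.single j 1 : κ → ℂ) by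
    rw [← Pi.single_smul, smul_eq_mul, mul_one], map_smul, smul_eq_mul, mul_comm]

end MultiIndexDeriv

/-! ### Taylor coefficients as iterated derivatives, and division by powers of a coordinate. -/

noncomputable section TaylorCoefficients

/-- The factorial `μ! = ∏ μᵢ!` of a multi-index. -/
def multiFactorial {ι : Type*} [Fintype ι] (μ : ι →₀ ℕ) : ℂ := ∏ i, (Nat.factorial (μ i) : ℂ)

theorem multiFactorial_ne_zero {ι : Type*} [Fintype ι] (μ : ι →₀ ℕ) : multiFactorial μ ≠ 0 :=
  Finset.prod_ne_zero_iff.2 fun i _ => by exact_mod_cast Nat.factorial_ne_zero _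

theorem multiFactorial_add_single {ι : Type*} [Fintype ι] (μ : ι →₀ ℕ) (i : ι) :
    multiFactorial (μ + Finsupp.single i 1) = multiFactorial μ * (μ i + 1) := by
  classical
  simp only [multiFactorial]
  rw [← Finset.mul_prod_erase _ _ (Finset.mem_univ i),
    ← Finset.mul_prod_erase Finset.univ (fun k => (Nat.factorial (μ k) : ℂ)) (Finset.mem_univ i)]
  have : ∏ k ∈ Finset.univ.erase i, (Nat.factorial ((μ + Finsupp.single i 1 : ι →₀ ℕ) k) : ℂ) =
      ∏ k ∈ Finset.univ.erase i, (Nat.factorial (μ k) : ℂ) := by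
    refine Finset.prod_congr rfl fun k hk => ?_
    rw [Finsupp.add_apply, Finsupp.single_eq_of_ne (Finset.ne_of_mem_erase hk), add_zero]
  rw [this]
  simp [Nat.factorial_succ]
  ring

section

variable {n m : ℕ}

theorem representedBy_partialDeriv {g : (Fin n → ℂ) → (Fin m → ℂ)}
    {a : Fin m → MvPowerSeries (Fin n) ℂ} (h : ∀ j, RepresentedBy (fun z => g z j) (a j))
    (i : Fin n) (j : Fin m) :
    RepresentedBy (fun z => partialDeriv i g z j) (MvPowerSeries.pderiv ℂ i (a j)) := by
  have hg : AnalyticAt ℂ g 0 := by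
    rw [analyticAt_pi_iff]; exact fun j => (h j).analyticAt
  refine ((h j).pderiv i).congr ?_
  filter_upwards [hg.eventually_analyticAt] with z hz
  have := (hasFDerivAt_pi'.1 hz.differentiableAt.hasFDerivAt j).fderiv
  rw [coordDeriv, this]
  rfl

/-- An arbitrary list of directions permits induction along the fold, and weighting coefficients by
μ! makes differentiation a pure index shift. -/
theorem exists_representedBy_iteratedPartialDeriv {g : (Fin n → ℂ) → (Fin m → ℂ)}
    {a : Fin m → MvPowerSeries (Fin n) ℂ} (h : ∀ j, RepresentedBy (fun z => g z j) (a j))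
    (α : Fin n → ℕ) (l : List (Fin n)) :
    ∃ a' : Fin m → MvPowerSeries (Fin n) ℂ,
      (∀ j, RepresentedBy
        (fun z => l.foldr (fun i g => (partialDeriv i)^[α i] g) g z j) (a' j)) ∧
      ∀ j μ, multiFactorial μ * MvPowerSeries.coeff μ (a' j) =
        multiFactorial (μ + (l.map fun i => Finsupp.single i (α i)).sum) *
          MvPowerSeries.coeff (μ + (l.map fun i => Finsupp.single i (α i)).sum) (a j) := by
  have step : ∀ (i : Fin n) (k : ℕ) (g' : (Fin n → ℂ) → (Fin m → ℂ))
      (a' : Fin m → MvPowerSeries (Fin n) ℂ), (∀ j, RepresentedBy (fun z => g' z j) (a' j)) →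
      ∃ a'' : Fin m → MvPowerSeries (Fin n) ℂ,
        (∀ j, RepresentedBy (fun z => (partialDeriv i)^[k] g' z j) (a'' j)) ∧
        ∀ j μ, multiFactorial μ * MvPowerSeries.coeff μ (a'' j) =
          multiFactorial (μ + Finsupp.single i k) *
            MvPowerSeries.coeff (μ + Finsupp.single i k) (a' j) := by
    intro i k g' a' h'
    induction k with
    | zero => exact ⟨a', h', by simp⟩
    | succ k ih =>
      obtain ⟨b, hb1, hb2⟩ := ih
      refine ⟨fun j => MvPowerSeries.pderiv ℂ i (b j), fun j => ?_, fun j μ => ?_⟩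
      · simp only [Function.iterate_succ', Function.comp_apply]
        exact representedBy_partialDeriv hb1 i j
      · have h1 := hb2 j (μ + Finsupp.single i 1)
        rw [multiFactorial_add_single, add_assoc, ← Finsupp.single_add, add_comm 1 k] at h1
        rw [← h1, MvPowerSeries.coeff_pderiv]
        ring
  induction l with
  | nil => exact ⟨a, h, by simp⟩
  | cons i l ih =>
    obtain ⟨b, hb1, hb2⟩ := ih
    obtain ⟨b', hb'1, hb'2⟩ := step i (α i) _ b hb1
    refine ⟨b', hb'1, fun j μ => ?_⟩
    rw [hb'2, hb2, List.map_cons, List.sum_cons, add_assoc]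

/-- The bridge between the jet coordinates of the theorem and the formal series used throughout the
proof. -/
theorem taylorCoeff_apply {g : (Fin n → ℂ) → (Fin m → ℂ)} (hg : AnalyticAt ℂ g 0)
    (α : Fin n → ℕ) (j : Fin m) :
    taylorCoeff α g j =
      MvPowerSeries.coeff (Finsupp.equivFunOnFinite.symm α) (taylorSeries fun z => g z j) := by
  have hj := fun j => ((analyticAt_pi_iff.1 hg) j).representedBy
  obtain ⟨a', h1, h2⟩ := exists_representedBy_iteratedPartialDeriv hj α (List.finRange n)
  have hsum : ((List.finRange n).map fun i => Finsupp.single i (α i)).sum =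
      Finsupp.equivFunOnFinite.symm α := by
    rw [← List.ofFn_eq_map, List.sum_ofFn]
    ext i
    simp [Finsupp.finsetSum_apply, Finsupp.single_apply]
  have h3 := h2 j 0
  rw [zero_add, hsum] at h3
  rw [taylorCoeff, Pi.smul_apply, smul_eq_mul, iteratedPartialDeriv, (h1 j).apply_zero]
  have h4 : multiFactorial (Finsupp.equivFunOnFinite.symm α) = ∏ i, (Nat.factorial (α i) : ℂ) := by
    simp [multiFactorial]
  have h5 : multiFactorial (0 : Fin n →₀ ℕ) = 1 := by simp [multiFactorial]
  rw [h5, one_mul, h4] at h3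
  rw [h3, inv_mul_cancel_left₀ (h4 ▸ multiFactorial_ne_zero _)]

end

section Division

variable {ι : Type*}

/-- The power series obtained by dropping all monomials of degree less than `d` in the `i`-th
variable and dividing the others by its `d`-th power. -/
def shiftSeries (i : ι) (d : ℕ) (a : MvPowerSeries ι ℂ) : MvPowerSeries ι ℂ :=
  fun μ => MvPowerSeries.coeff (μ + Finsupp.single i d) a

theorem coeff_shiftSeries (i : ι) (d : ℕ) (a : MvPowerSeries ι ℂ) (μ : ι →₀ ℕ) :
    MvPowerSeries.coeff μ (shiftSeries i d a) = MvPowerSeries.coeff (μ + Finsupp.single i d) a :=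
  rfl

theorem shiftSeries_X_pow_mul (i : ι) (d : ℕ) (a : MvPowerSeries ι ℂ) :
    shiftSeries i d (MvPowerSeries.X i ^ d * a) = a := by
  ext μ
  rw [coeff_shiftSeries, MvPowerSeries.X_pow_eq, add_comm, MvPowerSeries.coeff_add_monomial_mul,
    one_mul]

theorem X_pow_mul_shiftSeries {i : ι} {d : ℕ} {a : MvPowerSeries ι ℂ}
    (h : ∀ μ : ι →₀ ℕ, μ i < d → MvPowerSeries.coeff μ a = 0) :
    MvPowerSeries.X i ^ d * shiftSeries i d a = a := by
  ext μ
  rw [MvPowerSeries.X_pow_eq, MvPowerSeries.coeff_monomial_mul]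
  split_ifs with hμ
  · rw [coeff_shiftSeries, one_mul, tsub_add_cancel_of_le hμ]
  · rw [Finsupp.single_le_iff, not_le] at hμ
    exact (h μ hμ).symm

variable [Fintype ι]

theorem RepresentedBy.restrict [DecidableEq ι] {f : (ι → ℂ) → ℂ} {a : MvPowerSeries ι ℂ}
    (h : RepresentedBy f a) (i : ι) :
    RepresentedBy (fun z => f (Function.update z i 0))
      (fun μ => if μ i = 0 then MvPowerSeries.coeff μ a else 0) := by
  obtain ⟨r, hr⟩ := h
  have hc : ∀ μ, MvPowerSeries.coeff μ
      (fun μ => if μ i = 0 then MvPowerSeries.coeff μ a else 0 : MvPowerSeries ι ℂ) =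
        if μ i = 0 then MvPowerSeries.coeff μ a else 0 := fun μ => rfl
  refine ⟨r, hr.pos, hr.summable.of_nonneg_of_le (fun μ => by have := hr.pos; positivity)
    fun μ => ?_, fun z hz => ?_⟩
  · rw [hc]
    have := hr.pos
    gcongr
    split_ifs <;> simp
  · have h1 := hr.hasSum (Function.update z i 0) fun k => by
      by_cases hk : k = i
      · subst hk; simpa using hr.pos.le
      · rw [Function.update_of_ne hk]; exact hz k
    convert! h1 using 2 with μ
    rw [hc, prod_update_pow]
    split_ifs with hμ
    · rw [← Finset.mul_prod_erase _ _ (Finset.mem_univ i), hμ, pow_zero, pow_zero]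
    · rw [zero_pow hμ]; simp

/-- Two analytic functions that agree on the hyperplane `zᵢ = 0` have the same Taylor coefficients
of degree `0` in `zᵢ`. -/
theorem coeff_taylorSeries_eq_of_hyperplane {f g : (ι → ℂ) → ℂ} {i : ι} (hf : AnalyticAt ℂ f 0)
    (hg : AnalyticAt ℂ g 0) (hfg : ∀ᶠ z in 𝓝 0, z i = 0 → f z = g z) {μ : ι →₀ ℕ}
    (hμ : μ i = 0) :
    MvPowerSeries.coeff μ (taylorSeries f) = MvPowerSeries.coeff μ (taylorSeries g) := by
  classical
  have hcont : Tendsto (fun z : ι → ℂ => Function.update z i 0) (𝓝 0) (𝓝 0) := by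
    have : Continuous fun z : ι → ℂ => Function.update z i 0 :=
      continuous_id.update i continuous_const
    have h0 := this.tendsto 0
    rwa [show Function.update (0 : ι → ℂ) i (0 : ℂ) = 0 from Function.update_eq_self i (0 : ι → ℂ)] at h0
  have h1 := (hf.representedBy.restrict i).congr (g := fun z => g (Function.update z i 0)) (by
    filter_upwards [hcont.eventually hfg] with z hz
    exact hz (by simp))
  have h2 := congrArg (MvPowerSeries.coeff μ) (h1.unique (hg.representedBy.restrict i))
  change (if μ i = 0 then _ else _) = (if μ i = 0 then _ else _) at h2
  rwa [if_pos hμ, if_pos hμ] at h2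

theorem representedBy_coord_pow (i : ι) (d : ℕ) :
    RepresentedBy (fun z : ι → ℂ => z i ^ d) (MvPowerSeries.X i ^ d) := by
  induction d with
  | zero => simpa using representedBy_const (1 : ℂ)
  | succ d ih => simpa only [pow_succ] using ih.mul (representedBy_coord i)

/-- An analytic function whose Taylor coefficients of degree less than `d` in `zᵢ` vanish is
divisible by `zᵢ ^ d`. -/
theorem exists_eventuallyEq_pow_mul {f : (ι → ℂ) → ℂ} {i : ι} {d : ℕ} (hf : AnalyticAt ℂ f 0)
    (h : ∀ μ : ι →₀ ℕ, μ i < d → MvPowerSeries.coeff μ (taylorSeries f) = 0) :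
    ∃ G : (ι → ℂ) → ℂ, RepresentedBy G (shiftSeries i d (taylorSeries f)) ∧
      ∀ᶠ z in 𝓝 0, f z = z i ^ d * G z := by
  obtain ⟨r, hr⟩ := hf.representedBy
  have hpos := hr.pos
  have hs : Summable fun μ : ι →₀ ℕ =>
      ‖MvPowerSeries.coeff μ (shiftSeries i d (taylorSeries f))‖ * r ^ μ.degree := by
    have h1 := (hr.summable.comp_injective
      (add_left_injective (Finsupp.single i d))).mul_right (r ^ d)⁻¹
    refine h1.congr fun μ => ?_
    simp only [Function.comp_apply, coeff_shiftSeries, map_add, Finsupp.degree_single, pow_add]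
    field_simp
  have hG : RepresentedBy _ (shiftSeries i d (taylorSeries f)) :=
    ⟨r, HasMvSeries.of_summable hr.pos hs⟩
  refine ⟨_, hG, ?_⟩
  have h2 := (representedBy_coord_pow i d).mul hG
  rw [X_pow_mul_shiftSeries h] at h2
  exact hf.representedBy.eventuallyEq h2

end Division

end TaylorCoefficients

/-! ### Taylor coefficients of compositions and leading forms. -/

noncomputable section Composition

section LeadingForm

variable {κ : Type*} [Fintype κ]

/-- The value at `w` of the homogeneous part of degree `d` of the power series `a`. -/
def homogeneousValue (a : MvPowerSeries κ ℂ) (d : ℕ) (w : κ → ℂ) : ℂ :=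
  ∑ ν ∈ (Finsupp.finite_of_degree_eq (σ := κ) d).toFinset,
    MvPowerSeries.coeff ν a * ∏ k, w k ^ ν k

theorem prod_pow_add_single (w : κ → ℂ) (ν : κ →₀ ℕ) (j : κ) :
    ∏ k, w k ^ (ν + Finsupp.single j 1 : κ →₀ ℕ) k = (∏ k, w k ^ ν k) * w j := by
  classical
  simp only [Finsupp.add_apply, pow_add, Finset.prod_mul_distrib]
  congr 1
  rw [Finset.prod_eq_single j (fun k _ hk => by rw [Finsupp.single_eq_of_ne hk, pow_zero])
    (fun h => absurd (Finset.mem_univ j) h), Finsupp.single_eq_same, pow_one]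

/-- Euler's identity for homogeneous forms. -/
theorem sum_mul_homogeneousValue_pderiv (a : MvPowerSeries κ ℂ) (d : ℕ) (w : κ → ℂ) :
    ∑ j, homogeneousValue (MvPowerSeries.pderiv ℂ j a) d w * w j =
      (d + 1) * homogeneousValue a (d + 1) w := by
  have h1 : (d + 1 : ℂ) * homogeneousValue a (d + 1) w =
      ∑ ν ∈ (Finsupp.finite_of_degree_eq (σ := κ) (d + 1)).toFinset,
        ∑ j, (ν j : ℂ) * (MvPowerSeries.coeff ν a * ∏ k, w k ^ ν k) := by
    rw [homogeneousValue, Finset.mul_sum]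
    refine Finset.sum_congr rfl fun ν hν => ?_
    have hν' : ν.degree = d + 1 := by simpa using hν
    rw [← Finset.sum_mul]
    congr 1
    rw [Finsupp.degree_eq_sum] at hν'
    exact_mod_cast hν'.symm
  rw [h1, Finset.sum_comm]
  refine Finset.sum_congr rfl fun j _ => ?_
  rw [homogeneousValue, Finset.sum_mul]
  refine Finset.sum_of_injOn (fun ν => ν + Finsupp.single j 1)
    (add_left_injective _).injOn ?_ ?_ ?_
  · intro ν hν
    have : ν.degree = d := by simpa using hν
    simp [this]
  · intro ν hν hν'
    by_cases h0 : ν j = 0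
    · simp [h0]
    · obtain ⟨ν', rfl⟩ := exists_add_single h0
      refine absurd ⟨ν', ?_, rfl⟩ hν'
      simpa using hν
  · intro ν _
    rw [MvPowerSeries.coeff_pderiv, prod_pow_add_single]
    simp
    ring

/-- Take d to be the order of `a`: its leading form is a nonzero polynomial, hence a nonzero
function over the infinite field ℂ. -/
theorem exists_homogeneousValue_ne_zero {a : MvPowerSeries κ ℂ} (ha : a ≠ 0) :
    ∃ d w, (∀ ν : κ →₀ ℕ, ν.degree < d → MvPowerSeries.coeff ν a = 0) ∧
      homogeneousValue a d w ≠ 0 := by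
  classical
  have hex : ∃ d, ∃ ν : κ →₀ ℕ, ν.degree = d ∧ MvPowerSeries.coeff ν a ≠ 0 := by
    by_contra! h
    exact ha (MvPowerSeries.ext fun ν => by simpa using h _ ν rfl)
  obtain ⟨ν, hν, hν0⟩ := Nat.find_spec hex
  set d := Nat.find hex
  let P : MvPolynomial κ ℂ := ∑ ν ∈ (Finsupp.finite_of_degree_eq (σ := κ) d).toFinset,
    MvPolynomial.monomial ν (MvPowerSeries.coeff ν a)
  have hP : P ≠ 0 := by
    intro h
    have h1 := congrArg (MvPolynomial.coeff ν) h
    simp only [P, MvPolynomial.coeff_sum, MvPolynomial.coeff_monomial, MvPolynomial.coeff_zero,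
      Finset.sum_ite_eq'] at h1
    rw [if_pos (by simpa using hν)] at h1
    exact hν0 h1
  obtain ⟨w, hw⟩ : ∃ w, MvPolynomial.eval w P ≠ 0 := by
    by_contra! h
    exact hP (MvPolynomial.funext fun w => by simpa using h w)
  refine ⟨d, w, fun ν' hν' => ?_, ?_⟩
  · by_contra h
    exact Nat.find_min hex hν' ⟨ν', rfl, h⟩
  · convert hw
    rw [homogeneousValue, map_sum]
    refine Finset.sum_congr rfl fun ν _ => ?_
    rw [MvPolynomial.eval_monomial, Finsupp.prod_fintype _ _ fun _ => pow_zero _]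

end LeadingForm

variable {ι κ : Type*} [Fintype ι] [Fintype κ]

/-- The chain rule read off coefficientwise. It is a recursion on the degree that takes the place of
an explicit formula for composed series. -/
theorem coeff_add_single_taylorSeries_comp [DecidableEq ι] [DecidableEq κ] {θ : (κ → ℂ) → ℂ}
    {C : (ι → ℂ) → (κ → ℂ)} (hC : ∀ j, AnalyticAt ℂ (fun z => C z j) 0) (hC0 : C 0 = 0)
    (hθ : AnalyticAt ℂ θ 0) (i : ι) (ν : ι →₀ ℕ) :
    MvPowerSeries.coeff (ν + Finsupp.single i 1) (taylorSeries fun z => θ (C z)) * (ν i + 1) =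
      ∑ j, ∑ p ∈ Finset.HasAntidiagonal.antidiagonal ν,
        MvPowerSeries.coeff p.1 (taylorSeries fun z => coordDeriv j θ (C z)) *
          (MvPowerSeries.coeff (p.2 + Finsupp.single i 1) (taylorSeries fun z => C z j) *
            (p.2 i + 1)) := by
  classical
  rw [← MvPowerSeries.coeff_pderiv, pderiv_taylorSeries_comp hC hC0 hθ, map_sum]
  refine Finset.sum_congr rfl fun j _ => ?_
  rw [MvPowerSeries.coeff_mul]
  exact Finset.sum_congr rfl fun p _ => by rw [MvPowerSeries.coeff_pderiv]

theorem coeff_taylorSeries_coordDeriv [DecidableEq κ] {θ : (κ → ℂ) → ℂ} (hθ : AnalyticAt ℂ θ 0)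
    (j : κ) (ν : κ →₀ ℕ) : MvPowerSeries.coeff ν (taylorSeries (coordDeriv j θ)) =
      MvPowerSeries.coeff (ν + Finsupp.single j 1) (taylorSeries θ) * (ν j + 1) := by
  rw [taylorSeries_coordDeriv hθ, MvPowerSeries.coeff_pderiv]

section Vanishing

variable {C : (ι → ℂ) → (κ → ℂ)} {o : ι}

/-- If every component of C is divisible by z_o and δ has order at least d, then δ∘C is divisible by
z_o^d. The induction uses that the partial derivatives of δ lose only one order. -/
theorem coeff_taylorSeries_comp_eq_zero (hC : ∀ j, AnalyticAt ℂ (fun z => C z j) 0)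
    (hC0 : C 0 = 0)
    (hCo : ∀ j μ, μ o = 0 → MvPowerSeries.coeff μ (taylorSeries fun z => C z j) = 0) (d : ℕ) :
    ∀ δ : (κ → ℂ) → ℂ, AnalyticAt ℂ δ 0 →
      (∀ ν : κ →₀ ℕ, ν.degree < d → MvPowerSeries.coeff ν (taylorSeries δ) = 0) →
      ∀ μ : ι →₀ ℕ, μ o < d →
        MvPowerSeries.coeff μ (taylorSeries fun z => δ (C z)) = 0 := by
  classical
  have hCa : AnalyticAt ℂ C 0 := analyticAt_pi_iff.2 hC
  induction d with
  | zero => simp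
  | succ d ih =>
    intro δ hδ hvan μ hμ
    by_cases hμ0 : μ = 0
    · rw [hμ0, coeff_zero_taylorSeries (hδ.fun_comp_of_eq hCa hC0), hC0,
        ← coeff_zero_taylorSeries hδ]
      exact hvan 0 (by simp)
    -- Differentiate in z_o whenever it occurs, which lowers the order needed. If it does not occur,
    -- any direction works, since the factors coming from C then vanish.
    obtain ⟨i, hi, hio⟩ : ∃ i, μ i ≠ 0 ∧ (μ o ≠ 0 → i = o) := by
      by_cases h : μ o = 0
      · obtain ⟨i, hi⟩ := Finsupp.ne_iff.1 hμ0
        exact ⟨i, hi, fun h' => absurd h h'⟩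
      · exact ⟨o, h, fun _ => rfl⟩
    obtain ⟨ν, rfl⟩ := exists_add_single hi
    have h1 := coeff_add_single_taylorSeries_comp hC hC0 hδ i ν
    rw [Finset.sum_eq_zero fun j _ => Finset.sum_eq_zero fun p hp => ?_] at h1
    · exact (mul_eq_zero.1 h1).resolve_right (Nat.cast_add_one_ne_zero _)
    have hp' := Finset.HasAntidiagonal.mem_antidiagonal.1 hp
    have hpo : p.1 o + p.2 o = ν o := by rw [← hp', Finsupp.add_apply]
    by_cases h : (ν + Finsupp.single i 1 : ι →₀ ℕ) o = 0
    · rw [hCo j, zero_mul, mul_zero]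
      simp only [Finsupp.add_apply] at h ⊢
      omega
    · obtain rfl := hio h
      rw [ih _ (hδ.coordDeriv j) (fun ν' hν' => ?_), zero_mul]
      · simp at hμ
        omega
      · rw [coeff_taylorSeries_coordDeriv hδ, hvan _ (by simpa using hν'), zero_mul]

/-- With C = z_o(w + …), the lowest term of δ∘C in z_o alone is the leading form of δ at w. Euler's
identity reassembles that form from the partial derivatives of δ. -/
theorem coeff_single_taylorSeries_comp (hC : ∀ j, AnalyticAt ℂ (fun z => C z j) 0)
    (hC0 : C 0 = 0)
    (hCo : ∀ j μ, μ o = 0 → MvPowerSeries.coeff μ (taylorSeries fun z => C z j) = 0) (d : ℕ) :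
    ∀ δ : (κ → ℂ) → ℂ, AnalyticAt ℂ δ 0 →
      (∀ ν : κ →₀ ℕ, ν.degree < d → MvPowerSeries.coeff ν (taylorSeries δ) = 0) →
      MvPowerSeries.coeff (Finsupp.single o d) (taylorSeries fun z => δ (C z)) =
        homogeneousValue (taylorSeries δ) d fun j =>
          MvPowerSeries.coeff (Finsupp.single o 1) (taylorSeries fun z => C z j) := by
  classical
  have hCa : AnalyticAt ℂ C 0 := analyticAt_pi_iff.2 hC
  induction d with
  | zero =>
    intro δ hδ _
    rw [Finsupp.single_zero, coeff_zero_taylorSeries (hδ.fun_comp_of_eq hCa hC0), hC0,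
      ← coeff_zero_taylorSeries hδ, homogeneousValue]
    have : (Finsupp.finite_of_degree_eq (σ := κ) 0).toFinset = {0} := by
      ext ν; simp [Finsupp.degree_eq_zero_iff]
    rw [this]
    simp
  | succ d ih =>
    intro δ hδ hvan
    have hvan' : ∀ j (ν : κ →₀ ℕ), ν.degree < d →
        MvPowerSeries.coeff ν (taylorSeries (coordDeriv j δ)) = 0 := fun j ν' hν' => by
      rw [coeff_taylorSeries_coordDeriv hδ, hvan _ (by simpa using hν'), zero_mul]
    have h1 := coeff_add_single_taylorSeries_comp hC hC0 hδ o (Finsupp.single o d)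
    rw [← Finsupp.single_add] at h1
    have h2 : ∀ j, ∑ p ∈ Finset.HasAntidiagonal.antidiagonal (Finsupp.single o d),
        MvPowerSeries.coeff p.1 (taylorSeries fun z => coordDeriv j δ (C z)) *
          (MvPowerSeries.coeff (p.2 + Finsupp.single o 1) (taylorSeries fun z => C z j) *
            (p.2 o + 1)) =
        homogeneousValue (MvPowerSeries.pderiv ℂ j (taylorSeries δ)) d (fun j =>
          MvPowerSeries.coeff (Finsupp.single o 1) (taylorSeries fun z => C z j)) *
        MvPowerSeries.coeff (Finsupp.single o 1) (taylorSeries fun z => C z j) := by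
      intro j
      -- Every other splitting leaves fewer than d factors z_o for ∂_jδ∘C, where its coefficient
      -- vanishes.
      rw [Finset.sum_eq_single (Finsupp.single o d, 0)]
      · rw [ih _ (hδ.coordDeriv j) (hvan' j), taylorSeries_coordDeriv hδ]
        simp
      · intro p hp hne
        have hp' := Finset.HasAntidiagonal.mem_antidiagonal.1 hp
        rw [coeff_taylorSeries_comp_eq_zero hC hC0 hCo d _ (hδ.coordDeriv j) (hvan' j), zero_mul]
        by_contra! hle
        refine hne ?_
        have h3 : p.1 = Finsupp.single o d := by
          refine le_antisymm ?_ (Finsupp.single_le_iff.2 hle)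
          rw [← hp']; exact le_self_add
        refine Prod.ext h3 ?_
        rw [h3] at hp'
        exact add_eq_left.1 hp'
      · intro h
        exact absurd (Finset.HasAntidiagonal.mem_antidiagonal.2 (add_zero _)) h
    rw [Finset.sum_congr rfl fun j _ => h2 j, sum_mul_homogeneousValue_pderiv, mul_comm,
      Finsupp.single_eq_same] at h1
    exact mul_left_cancel₀ (Nat.cast_add_one_ne_zero d) h1

end Vanishing

theorem Subalgebra.sum_fun_mem {X γ : Type*} (S : Subalgebra ℂ (X → ℂ)) (t : Finset γ)
    (F : γ → X → ℂ) (h : ∀ k ∈ t, F k ∈ S) : (fun x => ∑ k ∈ t, F k x) ∈ S := by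
  have := S.sum_mem h
  convert this using 2 with x
  simp

theorem Subalgebra.mul_const_fun_mem {X : Type*} (S : Subalgebra ℂ (X → ℂ)) (w : ℂ) {f : X → ℂ}
    (hf : f ∈ S) : (fun x => f x * w) ∈ S := by
  have := S.smul_mem hf w
  convert this using 2 with x
  simp [mul_comm]

/-- Weighted bounds for the Taylor coefficients of the compositions of two families of germs. -/
theorem coeff_taylorSeries_comp_mem {X : Type*} {A : ℕ → Subalgebra ℂ (X → ℂ)}
    (hA : Monotone A) (φ : (ι →₀ ℕ) →+ ℕ) {C : X → (ι → ℂ) → (κ → ℂ)}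
    (hC : ∀ x j, AnalyticAt ℂ (fun z => C x z j) 0) (hC0 : ∀ x, C x 0 = 0)
    (hCA : ∀ j μ, (fun x => MvPowerSeries.coeff μ (taylorSeries fun z => C x z j)) ∈ A (φ μ))
    (hCφ : ∀ j μ, φ μ = 0 → ∀ x, MvPowerSeries.coeff μ (taylorSeries fun z => C x z j) = 0)
    (μ : ι →₀ ℕ) :
    ∀ (s : ℕ) (θ : X → (κ → ℂ) → ℂ), (∀ x, AnalyticAt ℂ (θ x) 0) →
      (∀ ν, (fun x => MvPowerSeries.coeff ν (taylorSeries (θ x))) ∈ A (s + ν.degree)) →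
      (fun x => MvPowerSeries.coeff μ (taylorSeries fun z => θ x (C x z))) ∈ A (s + φ μ) := by
  classical
  induction hk : μ.degree using Nat.strong_induction_on generalizing μ with
  | _ k ih =>
  intro s θ hθ hθA
  have hCa : ∀ x, AnalyticAt ℂ (C x) 0 := fun x => analyticAt_pi_iff.2 (hC x)
  by_cases hμ0 : μ = 0
  · subst hμ0
    have h0 := hθA 0
    rw [map_zero] at h0 ⊢
    convert h0 using 2 with x
    rw [coeff_zero_taylorSeries ((hθ x).fun_comp_of_eq (hCa x) (hC0 x)), hC0,
      coeff_zero_taylorSeries (hθ x)]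
  obtain ⟨i, hi⟩ := Finsupp.ne_iff.1 hμ0
  obtain ⟨ν, rfl⟩ := exists_add_single hi
  have key : (fun x => MvPowerSeries.coeff (ν + Finsupp.single i 1)
      (taylorSeries fun z => θ x (C x z)) * ((ν i : ℂ) + 1)) ∈
        A (s + φ (ν + Finsupp.single i 1)) := by
    simp_rw [fun x => coeff_add_single_taylorSeries_comp (hC x) (hC0 x) (hθ x) i ν]
    refine (A _).sum_fun_mem _ _ fun j _ => (A _).sum_fun_mem _ _ fun p hp => ?_
    have hp' := Finset.HasAntidiagonal.mem_antidiagonal.1 hp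
    -- Differentiating θ raises the offset `s` by 1. A coefficient of C of positive weight pays for
    -- this, and one of weight zero vanishes.
    by_cases h0 : φ (p.2 + Finsupp.single i 1) = 0
    · simp_rw [hCφ j _ h0, zero_mul, mul_zero]
      exact (A _).zero_mem
    · refine (A (s + φ (ν + Finsupp.single i 1))).mul_mem
        (hA ?_ (ih p.1.degree ?_ p.1 rfl (s + 1) _ (fun x => (hθ x).coordDeriv j)
          fun ν' => ?_)) ((A _).mul_const_fun_mem _ (hA ?_ (hCA j _)))
      · rw [← hp', add_assoc p.1, map_add]
        omega
      · rw [← hk, ← hp', map_add, map_add, Finsupp.degree_single]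
        omega
      · simp_rw [fun x => coeff_taylorSeries_coordDeriv (hθ x) j ν']
        have := hθA (ν' + Finsupp.single j 1)
        rw [map_add, Finsupp.degree_single, add_comm ν'.degree, ← add_assoc] at this
        exact (A _).mul_const_fun_mem _ this
      · rw [← hp', add_assoc p.1, map_add φ p.1]
        omega
  have := (A _).mul_const_fun_mem ((ν i : ℂ) + 1)⁻¹ key
  convert this using 2 with x
  rw [mul_inv_cancel_right₀ (Nat.cast_add_one_ne_zero _)]

end Composition

/-! ### Freezing parameters and extracting diagonal coefficients. -/

noncomputable section Slices

variable {ι κ : Type*} [Fintype ι] [Fintype κ]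

/-- The power series in the first group of variables obtained by giving the second group the
value `y`. -/
def sliceSeries (a : MvPowerSeries (ι ⊕ κ) ℂ) (y : κ → ℂ) : MvPowerSeries ι ℂ :=
  fun μ => ∑' ν : κ →₀ ℕ, MvPowerSeries.coeff (Finsupp.sumElim μ ν) a * ∏ k, y k ^ ν k

theorem coeff_sliceSeries {ι : Type*} (a : MvPowerSeries (ι ⊕ κ) ℂ) (y : κ → ℂ) (μ : ι →₀ ℕ) :
    MvPowerSeries.coeff μ (sliceSeries a y) =
      ∑' ν : κ →₀ ℕ, MvPowerSeries.coeff (Finsupp.sumElim μ ν) a * ∏ k, y k ^ ν k :=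
  rfl

theorem degree_sumElim (μ : ι →₀ ℕ) (ν : κ →₀ ℕ) :
    (Finsupp.sumElim μ ν).degree = μ.degree + ν.degree := by
  simp [Finsupp.degree_eq_sum]

theorem summable_tsum_fiber {α β : Type*} (T : α × β → ℂ) {R : α → ℝ} (hR : ∀ a, 0 < R a)
    (h : Summable fun p => ‖T p‖ * R p.1) :
    (∀ a, Summable fun b => T (a, b)) ∧ Summable fun a => ‖∑' b, T (a, b)‖ * R a := by
  have hfib : ∀ a, Summable fun b => ‖T (a, b)‖ := fun a =>
    (summable_mul_right_iff (hR a).ne').1 (h.prod_factor a)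
  refine ⟨fun a => (hfib a).of_norm, h.prod.of_nonneg_of_le
    (fun a => mul_nonneg (norm_nonneg _) (hR a).le) fun a => ?_⟩
  change _ ≤ ∑' b, ‖T (a, b)‖ * R a
  rw [tsum_mul_right]
  exact mul_le_mul_of_nonneg_right (norm_tsum_le_tsum_norm (hfib a)) (hR a).le

theorem HasMvSeries.slice {a : MvPowerSeries (ι ⊕ κ) ℂ} {f : (ι ⊕ κ → ℂ) → ℂ} {r : ℝ}
    (h : HasMvSeries a f r) {y : κ → ℂ} (hy : ∀ k, ‖y k‖ ≤ r) :
    HasMvSeries (sliceSeries a y) (fun z => f (Sum.elim z y)) r := by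
  have hr := h.pos
  let e := Finsupp.sumFinsuppEquivProdFinsupp (α := ι) (β := κ) (γ := ℕ)
  have hs : Summable fun p : (ι →₀ ℕ) × (κ →₀ ℕ) =>
      ‖MvPowerSeries.coeff (Finsupp.sumElim p.1 p.2) a‖ * r ^ (p.1.degree + p.2.degree) := by
    have h0 := e.symm.summable_iff.2 h.summable
    refine h0.congr fun p => ?_
    rw [Function.comp_apply, ← degree_sumElim]
    congr 1
  have hb : ∀ p : (ι →₀ ℕ) × (κ →₀ ℕ),
      ‖MvPowerSeries.coeff (Finsupp.sumElim p.1 p.2) a * ∏ k, y k ^ p.2 k‖ * r ^ p.1.degree ≤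
      ‖MvPowerSeries.coeff (Finsupp.sumElim p.1 p.2) a‖ * r ^ (p.1.degree + p.2.degree) := by
    intro p
    rw [norm_mul, pow_add]
    have h0 := norm_monomial_le hy p.2
    rw [mul_comm (r ^ _), ← mul_assoc]
    gcongr
  have hs' : Summable fun p : (ι →₀ ℕ) × (κ →₀ ℕ) =>
      ‖MvPowerSeries.coeff (Finsupp.sumElim p.1 p.2) a * ∏ k, y k ^ p.2 k‖ * r ^ p.1.degree :=
    hs.of_nonneg_of_le (fun p => by positivity) hb
  obtain ⟨hfib, hsum⟩ := summable_tsum_fiber (fun p : (ι →₀ ℕ) × (κ →₀ ℕ) =>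
    MvPowerSeries.coeff (Finsupp.sumElim p.1 p.2) a * ∏ k, y k ^ p.2 k)
    (fun μ => pow_pos hr μ.degree) hs'
  refine ⟨hr, hsum, fun z hz => ?_⟩
  · have hzy : ∀ k, ‖Sum.elim z y k‖ ≤ r := by
      rintro (k | k)
      · exact hz k
      · exact hy k
    have h1 := e.symm.hasSum_iff.2 (h.hasSum _ hzy)
    refine h1.prod_fiberwise fun μ => ?_
    have h2 := (hfib μ).hasSum.mul_right (∏ i, z i ^ μ i)
    convert! h2 using 2 with ν
    simp only [Function.comp_apply]
    rw [Fintype.prod_sum_type, mul_comm (∏ i, _), ← mul_assoc]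
    rfl

/-- The multi-index on `Option ι` with `none`-component `k` and the other components given by
`μ`. -/
def optionIndex (k : ℕ) (μ : ι →₀ ℕ) : Option ι →₀ ℕ :=
  Finsupp.equivFunOnFinite.symm fun o => o.elim k μ

@[simp] theorem optionIndex_none (k : ℕ) (μ : ι →₀ ℕ) : optionIndex k μ none = k := rfl

@[simp] theorem optionIndex_some (k : ℕ) (μ : ι →₀ ℕ) (i : ι) :
    optionIndex k μ (some i) = μ i := rfl

theorem degree_optionIndex (k : ℕ) (μ : ι →₀ ℕ) :
    (optionIndex k μ).degree = k + μ.degree := by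
  simp [Finsupp.degree_eq_sum]

/-- The part of a power series in `ζ, σ, y` that consists of the monomials `ζ ^ (d + |α|) σ ^ α y ^ γ`,
rewritten as a power series in `z, y` with the monomials `z ^ α y ^ γ`. -/
def diagonalSeries (d : ℕ) (a : MvPowerSeries (Option ι ⊕ κ) ℂ) : MvPowerSeries (ι ⊕ κ) ℂ :=
  fun μ => MvPowerSeries.coeff (Finsupp.sumElim
    (optionIndex (d + (μ.comapDomain Sum.inl Sum.inl_injective.injOn).degree)
      (μ.comapDomain Sum.inl Sum.inl_injective.injOn))
    (μ.comapDomain Sum.inr Sum.inr_injective.injOn)) a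

theorem coeff_diagonalSeries {κ : Type*} (d : ℕ) (a : MvPowerSeries (Option ι ⊕ κ) ℂ) (μ : ι →₀ ℕ)
    (ν : κ →₀ ℕ) : MvPowerSeries.coeff (Finsupp.sumElim μ ν) (diagonalSeries d a) =
      MvPowerSeries.coeff (Finsupp.sumElim (optionIndex (d + μ.degree) μ) ν) a := by
  change MvPowerSeries.coeff _ a = _
  have h1 : (Finsupp.sumElim μ ν).comapDomain Sum.inl Sum.inl_injective.injOn = μ := by
    ext; simp
  have h2 : (Finsupp.sumElim μ ν).comapDomain Sum.inr Sum.inr_injective.injOn = ν := by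
    ext; simp
  rw [h1, h2]

theorem sliceSeries_diagonalSeries (d : ℕ) (a : MvPowerSeries (Option ι ⊕ κ) ℂ) (y : κ → ℂ)
    (μ : ι →₀ ℕ) : MvPowerSeries.coeff μ (sliceSeries (diagonalSeries d a) y) =
      MvPowerSeries.coeff (optionIndex (d + μ.degree) μ) (sliceSeries a y) := by
  simp_rw [coeff_sliceSeries, coeff_diagonalSeries]

/-- The monomial ζ^(d+|α|) σ^α y^γ has degree d + 2|α| + |γ|, so the original bound controls weights
r^(2|α|) r^|γ|. The condition r ≤ 1 allows r^|γ| to be weakened to r^(2|γ|). -/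
theorem HasMvSeries.summable_diagonalSeries {a : MvPowerSeries (Option ι ⊕ κ) ℂ}
    {f : (Option ι ⊕ κ → ℂ) → ℂ} {r : ℝ} (h : HasMvSeries a f r) (hr1 : r ≤ 1) (d : ℕ) :
    Summable fun μ : ι ⊕ κ →₀ ℕ =>
      ‖MvPowerSeries.coeff μ (diagonalSeries d a)‖ * (r ^ 2) ^ μ.degree := by
  have hr := h.pos
  let e := Finsupp.sumFinsuppEquivProdFinsupp (α := ι) (β := κ) (γ := ℕ)
  rw [← e.symm.summable_iff]
  let J : (ι →₀ ℕ) × (κ →₀ ℕ) → (Option ι ⊕ κ →₀ ℕ) := fun p =>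
    Finsupp.sumElim (optionIndex (d + p.1.degree) p.1) p.2
  have hJ : Function.Injective J := by
    rintro ⟨μ, ν⟩ ⟨μ', ν'⟩ hp
    refine Prod.ext (Finsupp.ext fun i => ?_) (Finsupp.ext fun k => ?_)
    · simpa [J] using DFunLike.congr_fun hp (Sum.inl (some i))
    · simpa [J] using DFunLike.congr_fun hp (Sum.inr k)
  have h1 := (h.summable.comp_injective hJ).mul_right (r ^ d)⁻¹
  refine h1.of_nonneg_of_le (fun p => by simp only [Function.comp_apply]; positivity) fun p => ?_
  have h2 : MvPowerSeries.coeff (e.symm p) (diagonalSeries d a) = MvPowerSeries.coeff (J p) a :=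
    coeff_diagonalSeries d a p.1 p.2
  have h3 : (e.symm p).degree = p.1.degree + p.2.degree := degree_sumElim p.1 p.2
  have h4 : (J p).degree = d + p.1.degree + p.1.degree + p.2.degree := by
    rw [degree_sumElim, degree_optionIndex]
  simp only [Function.comp_apply]
  rw [h2, h3, h4, mul_assoc]
  gcongr
  have h5 : r ^ (d + p.1.degree + p.1.degree + p.2.degree) * (r ^ d)⁻¹ =
      (r ^ 2) ^ p.1.degree * r ^ p.2.degree := by
    rw [pow_add, pow_add, pow_add, ← pow_mul, two_mul, pow_add]
    field_simp
  rw [h5, pow_add]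
  gcongr
  nlinarith

end Slices

/-! ### Substitution along rays z = ζ(v + σ). -/

noncomputable section Rays

variable {n : ℕ}

/-- The map `(ζ, σ) ↦ ζ (v + σ)`, where `ζ` is the coordinate `none`. -/
def rayMap (v : Fin n → ℂ) (z : Option (Fin n) → ℂ) : Fin n → ℂ :=
  fun j => z none * (v j + z (some j))

theorem representedBy_rayMap (v : Fin n → ℂ) (j : Fin n) :
    RepresentedBy (fun z => rayMap v z j)
      (MvPowerSeries.X none * (MvPowerSeries.C (v j) + MvPowerSeries.X (some j))) :=
  (representedBy_coord none).mul ((representedBy_const (v j)).add (representedBy_coord (some j)))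

theorem analyticAt_rayMap (v : Fin n → ℂ) : AnalyticAt ℂ (rayMap v) 0 :=
  analyticAt_pi_iff.2 fun j => (representedBy_rayMap v j).analyticAt

theorem rayMap_zero (v : Fin n → ℂ) : rayMap v 0 = 0 := by
  ext j; simp [rayMap]

theorem rayMap_of_none_eq_zero (v : Fin n → ℂ) {z : Option (Fin n) → ℂ} (hz : z none = 0) :
    rayMap v z = 0 := by
  ext j; simp [rayMap, hz]

theorem coeff_taylorSeries_rayMap_eq_zero (v : Fin n → ℂ) (j : Fin n) {μ : Option (Fin n) →₀ ℕ}
    (hμ : μ none = 0) : MvPowerSeries.coeff μ (taylorSeries fun z => rayMap v z j) = 0 := by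
  rw [coeff_taylorSeries_eq_of_hyperplane (g := fun _ => 0)
    (representedBy_rayMap v j).analyticAt analyticAt_const _ hμ]
  · rw [representedBy_zero.taylorSeries_eq, MvPowerSeries.coeff_zero]
  · exact Eventually.of_forall fun z hz => by simp [rayMap, hz]

theorem pderiv_none_taylorSeries_rayMap (v : Fin n → ℂ) (j : Fin n) :
    MvPowerSeries.pderiv ℂ none (taylorSeries fun z => rayMap v z j) =
      MvPowerSeries.C (v j) + MvPowerSeries.X (some j) := by
  classical
  rw [(representedBy_rayMap v j).taylorSeries_eq, Derivation.leibniz, map_add,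
    MvPowerSeries.pderiv_C, MvPowerSeries.pderiv_X_self,
    MvPowerSeries.pderiv_X_of_ne (by simp)]
  simp

theorem optionIndex_add_single_none {ι : Type*} [Fintype ι] (k : ℕ) (μ : ι →₀ ℕ) :
    optionIndex k μ + Finsupp.single none 1 = optionIndex (k + 1) μ := by
  ext (_ | i) <;> simp

theorem optionIndex_add {ι : Type*} [Fintype ι] (d k : ℕ) (μ : ι →₀ ℕ) :
    optionIndex (d + k) μ = optionIndex k μ + Finsupp.single none d := by
  ext (_ | i) <;> simp [add_comm]

theorem optionIndex_sub_single_some {ι : Type*} [Fintype ι] (k : ℕ) (μ : ι →₀ ℕ) (j : ι) :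
    optionIndex k μ - Finsupp.single (some j) 1 = optionIndex k (μ - Finsupp.single j 1) := by
  classical
  ext (_ | i)
  · simp
  · simp [Finsupp.single_apply]

theorem coeff_optionIndex_succ_taylorSeries_rayMap {u : (Fin n → ℂ) → ℂ} (hu : AnalyticAt ℂ u 0)
    (v : Fin n → ℂ) (k : ℕ) (α : Fin n →₀ ℕ) :
    MvPowerSeries.coeff (optionIndex (k + 1) α) (taylorSeries fun z => u (rayMap v z)) * (k + 1) =
      ∑ j, (MvPowerSeries.coeff (optionIndex k α)
          (taylorSeries fun z => coordDeriv j u (rayMap v z)) * v j +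
        -- The case distinction is needed because the subtraction is truncated: with α_j = 0 the
        -- factor σ_j cannot contribute.
        if α j = 0 then 0 else MvPowerSeries.coeff (optionIndex k (α - Finsupp.single j 1))
          (taylorSeries fun z => coordDeriv j u (rayMap v z))) := by
  have h1 := MvPowerSeries.coeff_pderiv (i := none) (taylorSeries fun z => u (rayMap v z))
    (optionIndex k α)
  rw [optionIndex_add_single_none, optionIndex_none] at h1
  rw [← h1, pderiv_taylorSeries_comp (fun j => (representedBy_rayMap v j).analyticAt)
    (rayMap_zero v) hu, map_sum]
  refine Finset.sum_congr rfl fun j _ => ?_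
  rw [pderiv_none_taylorSeries_rayMap, mul_add, map_add, MvPowerSeries.coeff_mul_C,
    MvPowerSeries.X, MvPowerSeries.coeff_mul_monomial, optionIndex_sub_single_some,
    mul_one]
  congr 1
  have hle : Finsupp.single (some j) 1 ≤ optionIndex k α ↔ α j ≠ 0 := by
    rw [Finsupp.single_le_iff, optionIndex_some, Nat.one_le_iff_ne_zero]
  by_cases h : α j = 0
  · rw [if_pos h, if_neg (by simpa [hle] using h)]
  · rw [if_neg h, if_pos (hle.2 h)]

theorem degree_sub_single {ι : Type*} {α : ι →₀ ℕ} {j : ι} (h : α j ≠ 0) :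
    (α - Finsupp.single j 1).degree + 1 = α.degree := by
  obtain ⟨β, rfl⟩ := exists_add_single h
  simp

/-- In u(ζ(v + σ)) = ∑ u_β ζ^|β| (v + σ)^β, the power ζ^k selects |β| = k. Thus σ-degree above k is
impossible, and at σ-degree k only the top part σ^β survives, so that v disappears from the
coefficient. -/
theorem coeff_taylorSeries_comp_rayMap (v : Fin n → ℂ) (k : ℕ) :
    ∀ (u : (Fin n → ℂ) → ℂ), AnalyticAt ℂ u 0 → ∀ α : Fin n →₀ ℕ,
      (k < α.degree →
        MvPowerSeries.coeff (optionIndex k α) (taylorSeries fun z => u (rayMap v z)) = 0) ∧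
      (α.degree = k →
        MvPowerSeries.coeff (optionIndex k α) (taylorSeries fun z => u (rayMap v z)) =
          MvPowerSeries.coeff α (taylorSeries u)) := by
  induction k with
  | zero =>
    intro u hu α
    have h1 : MvPowerSeries.coeff (optionIndex 0 α) (taylorSeries fun z => u (rayMap v z)) =
        MvPowerSeries.coeff (optionIndex 0 α) (MvPowerSeries.C (u 0)) := by
      rw [coeff_taylorSeries_eq_of_hyperplane (g := fun _ => u 0) (i := none)
        (hu.fun_comp_of_eq (analyticAt_rayMap v) (rayMap_zero v)) analyticAt_const _ rfl,
        (representedBy_const (u 0)).taylorSeries_eq]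
      exact Eventually.of_forall fun z hz => by rw [rayMap_of_none_eq_zero v hz]
    refine ⟨fun hα => ?_, fun hα => ?_⟩
    · rw [h1, MvPowerSeries.coeff_C_of_ne_zero]
      intro h
      have := congrArg Finsupp.degree h
      rw [degree_optionIndex, map_zero] at this
      omega
    · rw [Finsupp.degree_eq_zero_iff] at hα
      subst hα
      rw [h1, coeff_zero_taylorSeries hu]
      have : optionIndex 0 (0 : Fin n →₀ ℕ) = 0 := by ext (_ | _) <;> simp
      rw [this, MvPowerSeries.coeff_zero_C]
  | succ k ih =>
    intro u hu α
    have h1 := coeff_optionIndex_succ_taylorSeries_rayMap hu v k α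
    have hk : ((k : ℂ) + 1) ≠ 0 := Nat.cast_add_one_ne_zero k
    refine ⟨fun hα => ?_, fun hα => ?_⟩
    · rw [Finset.sum_eq_zero fun j _ => ?_] at h1
      · exact (mul_eq_zero.1 h1).resolve_right hk
      · rw [(ih _ (hu.coordDeriv j) α).1 (by omega), zero_mul, zero_add]
        split_ifs with h
        · rfl
        · exact (ih _ (hu.coordDeriv j) _).1 (by have := degree_sub_single h; omega)
    · have h2 : ∀ j, (MvPowerSeries.coeff (optionIndex k α)
            (taylorSeries fun z => coordDeriv j u (rayMap v z)) * v j +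
          if α j = 0 then 0 else MvPowerSeries.coeff (optionIndex k (α - Finsupp.single j 1))
            (taylorSeries fun z => coordDeriv j u (rayMap v z))) =
          (α j : ℂ) * MvPowerSeries.coeff α (taylorSeries u) := by
        intro j
        rw [(ih _ (hu.coordDeriv j) α).1 (by omega), zero_mul, zero_add]
        split_ifs with h
        · simp [h]
        · rw [(ih _ (hu.coordDeriv j) _).2 (by have := degree_sub_single h; omega),
            coeff_taylorSeries_coordDeriv hu]
          obtain ⟨β, rfl⟩ := exists_add_single h
          simp
          ring
      rw [Finset.sum_congr rfl fun j _ => h2 j, ← Finset.sum_mul] at h1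
      have h3 : (∑ j, (α j : ℂ)) = k + 1 := by
        rw [Finsupp.degree_eq_sum] at hα
        exact_mod_cast hα
      rw [h3, mul_comm] at h1
      exact mul_left_cancel₀ hk h1

/-- The Jacobian matrix at the origin. -/
def jacobianMatrix (c : (Fin n → ℂ) → (Fin n → ℂ)) : Matrix (Fin n) (Fin n) ℂ :=
  Matrix.of fun j i => fderiv ℂ c 0 (Pi.single i 1) j

theorem det_jacobianMatrix (c : (Fin n → ℂ) → (Fin n → ℂ)) :
    (jacobianMatrix c).det = (fderiv ℂ c 0).det := by
  have : jacobianMatrix c = LinearMap.toMatrix' (fderiv ℂ c 0 : (Fin n → ℂ) →ₗ[ℂ] (Fin n → ℂ)) := by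
    ext j i
    simp [jacobianMatrix, LinearMap.toMatrix'_apply]
  rw [this, LinearMap.det_toMatrix', ContinuousLinearMap.det]

theorem coordDeriv_apply_zero {c : (Fin n → ℂ) → (Fin n → ℂ)} (hc : AnalyticAt ℂ c 0)
    (i j : Fin n) : coordDeriv i (fun z => c z j) 0 = jacobianMatrix c j i := by
  have := (hasFDerivAt_pi'.1 hc.differentiableAt.hasFDerivAt j).fderiv
  rw [coordDeriv, this]
  rfl

/-- The direction that the Jacobian matrix of `c` maps to `w`. -/
def pullbackDirection (c : (Fin n → ℂ) → (Fin n → ℂ)) (w : Fin n → ℂ) : Fin n → ℂ :=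
  (jacobianMatrix c)⁻¹.mulVec w

variable {c : (Fin n → ℂ) → (Fin n → ℂ)}

theorem analyticAt_comp_rayMap (hc : AnalyticAt ℂ c 0) (v : Fin n → ℂ) (j : Fin n) :
    AnalyticAt ℂ (fun z => c (rayMap v z) j) 0 :=
  (analyticAt_pi_iff.1 hc j).fun_comp_of_eq (analyticAt_rayMap v) (rayMap_zero v)

theorem coeff_taylorSeries_comp_rayMap_eq_zero (hc : AnalyticAt ℂ c 0) (hc0 : c 0 = 0)
    (v : Fin n → ℂ) (j : Fin n) (μ : Option (Fin n) →₀ ℕ) (hμ : μ none = 0) :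
    MvPowerSeries.coeff μ (taylorSeries fun z => c (rayMap v z) j) = 0 := by
  rw [coeff_taylorSeries_eq_of_hyperplane (g := fun _ => 0)
    (analyticAt_comp_rayMap hc v j) analyticAt_const _ hμ]
  · rw [representedBy_zero.taylorSeries_eq, MvPowerSeries.coeff_zero]
  · exact Eventually.of_forall fun z hz => by rw [rayMap_of_none_eq_zero v hz, hc0]; rfl

theorem coeff_single_taylorSeries_comp_rayMap (hc : AnalyticAt ℂ c 0)
    (v : Fin n → ℂ) (j : Fin n) :
    MvPowerSeries.coeff (Finsupp.single none 1) (taylorSeries fun z => c (rayMap v z) j) =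
      (jacobianMatrix c).mulVec v j := by
  have hcj := analyticAt_pi_iff.1 hc j
  have h1 := congrArg (MvPowerSeries.coeff 0) (pderiv_taylorSeries_comp
    (fun j => (representedBy_rayMap v j).analyticAt) (rayMap_zero v) hcj none)
  rw [MvPowerSeries.coeff_pderiv, zero_add, map_sum] at h1
  simp only [Finsupp.coe_zero, Pi.zero_apply, Nat.cast_zero, zero_add, mul_one] at h1
  rw [h1, Matrix.mulVec, dotProduct]
  refine Finset.sum_congr rfl fun i _ => ?_
  rw [pderiv_none_taylorSeries_rayMap, MvPowerSeries.coeff_zero_eq_constantCoeff_apply, map_mul,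
    map_add, ← MvPowerSeries.coeff_zero_eq_constantCoeff_apply, coeff_zero_taylorSeries
    ((hcj.coordDeriv i).fun_comp_of_eq (analyticAt_rayMap v) (rayMap_zero v)), rayMap_zero,
    coordDeriv_apply_zero hc]
  simp

end Rays

/-! ### Coefficients of the quotient along rays. -/

noncomputable section Quotient

variable {n : ℕ}

/-- The numerator of the quotient along the rays in the direction of `w`. -/
def numeratorSeries (w : Fin n → ℂ) (c : (Fin n → ℂ) → (Fin n → ℂ)) (f : (Fin n → ℂ) → ℂ) :
    MvPowerSeries (Option (Fin n)) ℂ :=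
  taylorSeries fun z => f (rayMap (pullbackDirection c w) z)

/-- The denominator of the quotient along the rays in the direction of `w`, divided by `ζ ^ d`. -/
def denominatorSeries (Δ : (Fin n → ℂ) → ℂ) (d : ℕ) (w : Fin n → ℂ)
    (c : (Fin n → ℂ) → (Fin n → ℂ)) : MvPowerSeries (Option (Fin n)) ℂ :=
  shiftSeries none d (taylorSeries fun z => Δ (c (rayMap (pullbackDirection c w) z)))

/-- The Taylor coefficients of the quotient of `f` by `Δ ∘ c`, defined also when `Δ ∘ c` does not
divide `f`. -/
def quotientCoeff (Δ : (Fin n → ℂ) → ℂ) (d : ℕ) (w : Fin n → ℂ)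
    (c : (Fin n → ℂ) → (Fin n → ℂ)) (f : (Fin n → ℂ) → ℂ) (α : Fin n →₀ ℕ) : ℂ :=
  MvPowerSeries.coeff (optionIndex (d + α.degree) α)
    (numeratorSeries w c f * (denominatorSeries Δ d w c)⁻¹)

section

variable {Δ : (Fin n → ℂ) → ℂ} {d : ℕ} {w : Fin n → ℂ}
  {c : (Fin n → ℂ) → (Fin n → ℂ)} {f : (Fin n → ℂ) → ℂ}

/-- The ray direction is chosen so that the Jacobian of c sends it to w. The constant term is
therefore the same for all c, and inverting the denominator introduces no new denominators in the
jets. -/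
theorem coeff_zero_denominatorSeries (hΔ : AnalyticAt ℂ Δ 0)
    (hd : ∀ ν : Fin n →₀ ℕ, ν.degree < d → MvPowerSeries.coeff ν (taylorSeries Δ) = 0)
    (hc : AnalyticAt ℂ c 0) (hc0 : c 0 = 0) (hdet : (jacobianMatrix c).det ≠ 0) :
    MvPowerSeries.coeff 0 (denominatorSeries Δ d w c) =
      homogeneousValue (taylorSeries Δ) d w := by
  rw [denominatorSeries, coeff_shiftSeries, zero_add, coeff_single_taylorSeries_comp
    (C := fun z => c (rayMap (pullbackDirection c w) z))
    (analyticAt_comp_rayMap hc _) (by rw [rayMap_zero, hc0])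
    (coeff_taylorSeries_comp_rayMap_eq_zero hc hc0 _) d Δ hΔ hd]
  congr 1
  ext j
  rw [coeff_single_taylorSeries_comp_rayMap hc, pullbackDirection, Matrix.mulVec_mulVec,
    Matrix.mul_nonsing_inv _ (isUnit_iff_ne_zero.2 hdet), Matrix.one_mulVec]

theorem X_pow_mul_denominatorSeries (hΔ : AnalyticAt ℂ Δ 0)
    (hd : ∀ ν : Fin n →₀ ℕ, ν.degree < d → MvPowerSeries.coeff ν (taylorSeries Δ) = 0)
    (hc : AnalyticAt ℂ c 0) (hc0 : c 0 = 0) :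
    MvPowerSeries.X none ^ d * denominatorSeries Δ d w c =
      taylorSeries fun z => Δ (c (rayMap (pullbackDirection c w) z)) :=
  X_pow_mul_shiftSeries (coeff_taylorSeries_comp_eq_zero
    (C := fun z => c (rayMap (pullbackDirection c w) z))
    (analyticAt_comp_rayMap hc _) (by rw [rayMap_zero, hc0])
    (coeff_taylorSeries_comp_rayMap_eq_zero hc hc0 _) d Δ hΔ hd)

/-- If `Δ ∘ c` divides `f`, then the quotient has the expected Taylor coefficients. -/
theorem coeff_taylorSeries_eq_quotientCoeff (hΔ : AnalyticAt ℂ Δ 0)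
    (hd : ∀ ν : Fin n →₀ ℕ, ν.degree < d → MvPowerSeries.coeff ν (taylorSeries Δ) = 0)
    (hw : homogeneousValue (taylorSeries Δ) d w ≠ 0)
    (hc : AnalyticAt ℂ c 0) (hc0 : c 0 = 0) (hdet : (jacobianMatrix c).det ≠ 0)
    {u : (Fin n → ℂ) → ℂ} (hu : AnalyticAt ℂ u 0)
    (h : ∀ᶠ z in 𝓝 0, Δ (c z) * u z = f z) (α : Fin n →₀ ℕ) :
    MvPowerSeries.coeff α (taylorSeries u) = quotientCoeff Δ d w c f α := by
  set v := pullbackDirection c w with hv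
  have hray := analyticAt_rayMap v
  have h1 : ∀ᶠ z in 𝓝 (0 : Option (Fin n) → ℂ),
      Δ (c (rayMap v z)) * u (rayMap v z) = f (rayMap v z) := by
    have := hray.continuousAt.tendsto
    rw [rayMap_zero] at this
    exact this.eventually h
  have hΔc : AnalyticAt ℂ (fun z => Δ (c (rayMap v z))) 0 :=
    hΔ.fun_comp_of_eq (hc.fun_comp_of_eq hray (rayMap_zero v)) (by rw [rayMap_zero, hc0])
  have hur : AnalyticAt ℂ (fun z => u (rayMap v z)) 0 := hu.fun_comp_of_eq hray (rayMap_zero v)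
  have h2 := taylorSeries_congr (hΔc.mul hur) h1
  have h3 : taylorSeries (fun z => Δ (c (rayMap v z))) * taylorSeries (fun z => u (rayMap v z)) =
      numeratorSeries w c f := by
    rw [← taylorSeries_mul hΔc hur]
    exact h2
  rw [hv, ← X_pow_mul_denominatorSeries hΔ hd hc hc0, ← hv] at h3
  have hne : MvPowerSeries.constantCoeff (denominatorSeries Δ d w c) ≠ 0 := by
    rwa [← MvPowerSeries.coeff_zero_eq_constantCoeff_apply,
      coeff_zero_denominatorSeries hΔ hd hc hc0 hdet]
  -- The factor ζ^d stays on the side of u, which is why the coefficient is read off at ζ-degree d +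
  -- |α|.
  have h4 : MvPowerSeries.X none ^ d * taylorSeries (fun z => u (rayMap v z)) =
      numeratorSeries w c f * (denominatorSeries Δ d w c)⁻¹ := by
    rw [MvPowerSeries.eq_mul_inv_iff_mul_eq hne, ← h3]
    ring
  rw [quotientCoeff, ← h4, ← (coeff_taylorSeries_comp_rayMap v α.degree u hu α).2 rfl,
    optionIndex_add, add_comm, MvPowerSeries.X_pow_eq, MvPowerSeries.coeff_add_monomial_mul,
    one_mul]

end

section MatrixAnalytic

variable {E ι : Type*} [NormedAddCommGroup E] [NormedSpace ℂ E] [Fintype ι] [DecidableEq ι]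
  {M : E → Matrix ι ι ℂ} {x : E}

theorem AnalyticAt.matrix_det (h : ∀ i j, AnalyticAt ℂ (fun y => M y i j) x) :
    AnalyticAt ℂ (fun y => (M y).det) x := by
  simp only [Matrix.det_apply']
  refine Finset.analyticAt_fun_sum _ fun σ _ => analyticAt_const.mul ?_
  exact Finset.analyticAt_fun_prod _ fun i _ => h _ _

theorem AnalyticAt.matrix_adjugate (h : ∀ i j, AnalyticAt ℂ (fun y => M y i j) x) (i j : ι) :
    AnalyticAt ℂ (fun y => (M y).adjugate i j) x := by
  simp only [Matrix.adjugate_apply]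
  refine AnalyticAt.matrix_det fun k l => ?_
  by_cases hk : k = j
  · subst hk
    simp only [Matrix.updateRow_self]
    exact analyticAt_const
  · simp only [Matrix.updateRow_ne hk]
    exact h k l

theorem AnalyticAt.matrix_inv_mulVec (h : ∀ i j, AnalyticAt ℂ (fun y => M y i j) x)
    (hx : (M x).det ≠ 0) (w : ι → ℂ) : AnalyticAt ℂ (fun y => (M y)⁻¹.mulVec w) x := by
  refine analyticAt_pi_iff.2 fun i => ?_
  simp only [Matrix.inv_def, Ring.inverse_eq_inv', Matrix.smul_apply, smul_eq_mul,
    Matrix.mulVec, dotProduct]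
  exact Finset.analyticAt_fun_sum _ fun k _ => (((AnalyticAt.matrix_det h).inv hx).mul
    (AnalyticAt.matrix_adjugate h i k)).mul analyticAt_const

end MatrixAnalytic

theorem tendsto_sumElim_nhds_zero {ι κ : Type*} :
    Tendsto (fun p : (κ → ℂ) × (ι → ℂ) => Sum.elim p.2 p.1) (𝓝 (0, 0)) (𝓝 (0 : ι ⊕ κ → ℂ)) := by
  have h : Continuous fun p : (κ → ℂ) × (ι → ℂ) => Sum.elim p.2 p.1 := by
    refine continuous_pi ?_
    rintro (i | k)
    · exact (continuous_apply i).comp continuous_snd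
    · exact (continuous_apply k).comp continuous_fst
  have h0 : (Sum.elim (0 : ι → ℂ) (0 : κ → ℂ)) = 0 := by
    ext (_ | _) <;> rfl
  have := h.tendsto ((0 : κ → ℂ), (0 : ι → ℂ))
  rwa [h0] at this

theorem eventually_sumElim {ι κ : Type*} {P : (ι ⊕ κ → ℂ) → Prop} (h : ∀ᶠ w in 𝓝 0, P w) :
    ∀ᶠ y in 𝓝 (0 : κ → ℂ), ∀ᶠ z in 𝓝 (0 : ι → ℂ), P (Sum.elim z y) :=
  (tendsto_sumElim_nhds_zero.eventually h).curry_nhds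

theorem AnalyticAt.eventually_sumElim {ι κ : Type*} [Fintype ι] [Fintype κ]
    {F : (ι ⊕ κ → ℂ) → ℂ} (h : AnalyticAt ℂ F 0) :
    ∀ᶠ y in 𝓝 (0 : κ → ℂ), AnalyticAt ℂ (fun z : ι → ℂ => F (Sum.elim z y)) 0 := by
  filter_upwards [_root_.eventually_sumElim h.eventually_analyticAt] with y hy
  refine hy.self_of_nhds.fun_comp_of_eq (f := fun z : ι → ℂ => Sum.elim z y) ?_ rfl
  refine analyticAt_pi_iff.2 ?_
  rintro (i | k)
  · exact analyticAt_coord i 0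
  · exact analyticAt_const

/-! ### Holomorphic dependence of the quotient on parameters. -/

section Local

variable {e : ℕ} {Δ : (Fin n → ℂ) → ℂ} {d : ℕ} {w : Fin n → ℂ}
  {c : (Fin n → ℂ) × (Fin e → ℂ) → (Fin n → ℂ)} {f : (Fin n → ℂ) × (Fin e → ℂ) → ℂ}

theorem analyticAt_pullbackDirection (hc : AnalyticAt ℂ c (0, 0))
    (hdet : (jacobianMatrix fun z => c (z, 0)).det ≠ 0) :
    AnalyticAt ℂ (fun y => pullbackDirection (fun z => c (z, y)) w) 0 := by
  have hpair : AnalyticAt ℂ (fun y : Fin e → ℂ => ((0 : Fin n → ℂ), y)) 0 :=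
    analyticAt_const.prod analyticAt_id
  refine AnalyticAt.matrix_inv_mulVec (M := fun y : Fin e → ℂ => jacobianMatrix fun z => c (z, y))
    (fun j i => ?_) hdet w
  have h1 : AnalyticAt ℂ (fun y : Fin e → ℂ => fderiv ℂ c (0, y) (Pi.single i 1, 0) j) 0 := by
    have h2 := hc.fderiv.fun_comp_of_eq hpair rfl
    have h3 : AnalyticAt ℂ (fun y : Fin e → ℂ => fderiv ℂ c (0, y) (Pi.single i 1, 0)) 0 :=
      ((ContinuousLinearMap.apply ℂ (Fin n → ℂ)
        ((Pi.single i 1, 0) : (Fin n → ℂ) × (Fin e → ℂ))).analyticAt _).fun_comp_of_eq h2 rfl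
    exact analyticAt_pi_iff.1 h3 j
  refine h1.congr ?_
  have h4 : ∀ᶠ y in 𝓝 (0 : Fin e → ℂ), AnalyticAt ℂ c (0, y) :=
    hpair.continuousAt.eventually hc.eventually_analyticAt
  filter_upwards [h4] with y hy
  have h5 : HasFDerivAt (fun z : Fin n → ℂ => (z, y))
      (ContinuousLinearMap.inl ℂ (Fin n → ℂ) (Fin e → ℂ)) 0 := hasFDerivAt_prodMk_left 0 y
  have h6 := (hy.differentiableAt.hasFDerivAt (x := ((0 : Fin n → ℂ), y))).comp 0 h5
  simp only [jacobianMatrix, Matrix.of_apply]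
  rw [show fderiv ℂ (fun z => c (z, y)) 0 = _ from h6.fderiv]
  simp

/-- The quotients depend analytically on parameters. -/
theorem exists_analyticAt_hasSum_quotientCoeff (hΔ : AnalyticAt ℂ Δ 0)
    (hd : ∀ ν : Fin n →₀ ℕ, ν.degree < d → MvPowerSeries.coeff ν (taylorSeries Δ) = 0)
    (hw : homogeneousValue (taylorSeries Δ) d w ≠ 0)
    (hc : AnalyticAt ℂ c (0, 0)) (hc0 : ∀ᶠ y in 𝓝 (0 : Fin e → ℂ), c (0, y) = 0)
    (hdet : (jacobianMatrix fun z => c (z, 0)).det ≠ 0) (hf : AnalyticAt ℂ f (0, 0)) :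
    ∃ g : (Fin n → ℂ) × (Fin e → ℂ) → ℂ, AnalyticAt ℂ g (0, 0) ∧
      ∀ᶠ p in 𝓝 ((0 : Fin n → ℂ), (0 : Fin e → ℂ)), HasSum (fun α : Fin n →₀ ℕ =>
        quotientCoeff Δ d w (fun z => c (z, p.2)) (fun z => f (z, p.2)) α * ∏ i, p.1 i ^ α i)
        (g p) := by
  have hc00 : c (0, 0) = 0 := hc0.self_of_nhds
  set v : (Fin e → ℂ) → (Fin n → ℂ) := fun y => pullbackDirection (fun z => c (z, y)) w with hv
  have hva : AnalyticAt ℂ v 0 := analyticAt_pullbackDirection hc hdet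
  -- The ray substitution for all parameters at once, with direction v(y), so that ζ^d is divided
  -- out jointly in (ζ, σ, y).
  let P : (Option (Fin n) ⊕ Fin e → ℂ) → (Fin n → ℂ) × (Fin e → ℂ) := fun t =>
    (rayMap (v fun k => t (Sum.inr k)) fun i => t (Sum.inl i), fun k => t (Sum.inr k))
  have hinr : AnalyticAt ℂ (fun (t : Option (Fin n) ⊕ Fin e → ℂ) (k : Fin e) => t (Sum.inr k)) 0 :=
    analyticAt_pi_iff.2 fun k => analyticAt_coord _ _
  have hP0 : P 0 = (0, 0) := Prod.ext (rayMap_zero _) rfl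
  have hP : AnalyticAt ℂ P 0 := by
    refine AnalyticAt.prod (analyticAt_pi_iff.2 fun j => ?_) hinr
    refine (analyticAt_coord _ _).mul (AnalyticAt.add ?_ (analyticAt_coord _ _))
    exact analyticAt_pi_iff.1 (hva.fun_comp_of_eq hinr rfl) j
  have hPelim : ∀ (z : Option (Fin n) → ℂ) (y : Fin e → ℂ),
      P (Sum.elim z y) = (rayMap (v y) z, y) := fun z y => rfl
  have hcP : AnalyticAt ℂ (fun t => c (P t)) 0 := hc.fun_comp_of_eq hP hP0
  have hcP0 : c (P 0) = 0 := by rw [hP0, hc00]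
  have hcPj : ∀ j, AnalyticAt ℂ (fun t => c (P t) j) 0 := analyticAt_pi_iff.1 hcP
  have hcPvan : ∀ j (μ : Option (Fin n) ⊕ Fin e →₀ ℕ), μ (Sum.inl none) = 0 →
      MvPowerSeries.coeff μ (taylorSeries fun t => c (P t) j) = 0 := by
    intro j μ hμ
    rw [coeff_taylorSeries_eq_of_hyperplane (g := fun _ => 0) (hcPj j) analyticAt_const _ hμ]
    · rw [representedBy_zero.taylorSeries_eq, MvPowerSeries.coeff_zero]
    · have hinr0 : Tendsto (fun (t : Option (Fin n) ⊕ Fin e → ℂ) (k : Fin e) => t (Sum.inr k))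
          (𝓝 0) (𝓝 0) := hinr.continuousAt
      filter_upwards [hinr0.eventually hc0] with t ht h0
      have : P t = (0, fun k => t (Sum.inr k)) := Prod.ext
        (rayMap_of_none_eq_zero _ (z := fun i => t (Sum.inl i)) h0) rfl
      rw [this, ht]
      rfl
  have hg : AnalyticAt ℂ (fun t => Δ (c (P t))) 0 := hΔ.fun_comp_of_eq hcP hcP0
  obtain ⟨G, hGrep, hG⟩ := exists_eventuallyEq_pow_mul hg
    (coeff_taylorSeries_comp_eq_zero hcPj hcP0 hcPvan d Δ hΔ hd)
  have hGa := hGrep.analyticAt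
  have hF : AnalyticAt ℂ (fun t => f (P t)) 0 := hf.fun_comp_of_eq hP hP0
  -- the slices of the denominator
  have hslice : ∀ᶠ y in 𝓝 (0 : Fin e → ℂ),
      taylorSeries (fun z : Option (Fin n) → ℂ => G (Sum.elim z y)) =
        denominatorSeries Δ d w fun z => c (z, y) := by
    filter_upwards [eventually_sumElim hG, hGa.eventually_sumElim, hg.eventually_sumElim]
      with y hy1 hy2 hy3
    have h1 := taylorSeries_congr hy3 hy1
    have h2 : taylorSeries (fun z : Option (Fin n) → ℂ =>
        Sum.elim z y (Sum.inl none) ^ d * G (Sum.elim z y)) =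
        MvPowerSeries.X none ^ d * taylorSeries fun z => G (Sum.elim z y) :=
      ((representedBy_coord_pow none d).mul hy2.representedBy).taylorSeries_eq
    rw [denominatorSeries]
    change _ = shiftSeries none d (taylorSeries fun z => Δ (c (P (Sum.elim z y))))
    rw [h1, h2, shiftSeries_X_pow_mul]
  have hc_slice : AnalyticAt ℂ (fun z : Fin n → ℂ => c (z, (0 : Fin e → ℂ))) 0 :=
    hc.fun_comp_of_eq (analyticAt_id.prod analyticAt_const) rfl
  have hG0 : G 0 ≠ 0 := by
    have h1 := hslice.self_of_nhds
    have h2 := congrArg (MvPowerSeries.coeff 0) h1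
    rw [coeff_zero_taylorSeries hGa.eventually_sumElim.self_of_nhds,
      coeff_zero_denominatorSeries hΔ hd hc_slice hc00 hdet] at h2
    have h3 : (Sum.elim (0 : Option (Fin n) → ℂ) (0 : Fin e → ℂ)) = 0 := by
      ext (_ | _) <;> rfl
    rw [h3] at h2
    rwa [h2]
  have hHa : AnalyticAt ℂ (fun t => f (P t) / G t) 0 := hF.div hGa hG0
  obtain ⟨r₀, hr₀⟩ := hHa.representedBy
  set a := taylorSeries fun t => f (P t) / G t
  have hr := hr₀.mono (lt_min hr₀.pos one_pos) (min_le_left _ _)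
  set r := min r₀ 1
  have hr1 : r ≤ 1 := min_le_right _ _
  have hdiag := HasMvSeries.of_summable (pow_pos hr.pos 2) (hr.summable_diagonalSeries hr1 d)
  -- The candidate is the diagonal of the joint series of f/G. It remains to see that its slices in
  -- y are the fibrewise quotients.
  refine ⟨fun p => ∑' μ : Fin n ⊕ Fin e →₀ ℕ, MvPowerSeries.coeff μ (diagonalSeries d a) *
    ∏ i, Sum.elim p.1 p.2 i ^ μ i, ?_, ?_⟩
  · refine hdiag.analyticAt.fun_comp_of_eq
      (f := fun p : (Fin n → ℂ) × (Fin e → ℂ) => Sum.elim p.1 p.2) (analyticAt_pi_iff.2 ?_) ?_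
    · rintro (i | k)
      · exact (analyticAt_coord i _).fun_comp_of_eq analyticAt_fst rfl
      · exact (analyticAt_coord k _).fun_comp_of_eq analyticAt_snd rfl
    · ext (_ | _) <;> rfl
  · have hy : ∀ᶠ y in 𝓝 (0 : Fin e → ℂ),
        sliceSeries a y = numeratorSeries w (fun z => c (z, y)) (fun z => f (z, y)) *
          (denominatorSeries Δ d w fun z => c (z, y))⁻¹ := by
      filter_upwards [hslice, hGa.eventually_sumElim, hHa.eventually_sumElim,
        eventually_sumElim (hGa.continuousAt.eventually_ne hG0), eventually_polydisc hr.pos]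
        with y hy1 hy2 hy3 hy4 hy5
      have h1 : taylorSeries (fun z : Option (Fin n) → ℂ =>
          f (P (Sum.elim z y)) / G (Sum.elim z y)) = sliceSeries a y :=
        RepresentedBy.taylorSeries_eq ⟨r, hr.slice hy5⟩
      have h2 := taylorSeries_mul hy3 hy2
      have hne : MvPowerSeries.constantCoeff (denominatorSeries Δ d w fun z => c (z, y)) ≠ 0 := by
        rw [← MvPowerSeries.coeff_zero_eq_constantCoeff_apply, ← hy1,
          coeff_zero_taylorSeries hy2]
        exact hy4.self_of_nhds
      rw [MvPowerSeries.eq_mul_inv_iff_mul_eq hne, ← hy1, ← h1, ← h2]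
      refine taylorSeries_congr (hy3.mul hy2) ?_
      filter_upwards [hy4] with z hz
      rw [div_mul_cancel₀ _ hz, hPelim]
    have hfst : ∀ᶠ p in 𝓝 ((0 : Fin n → ℂ), (0 : Fin e → ℂ)), ∀ i, ‖p.1 i‖ ≤ r ^ 2 :=
      (continuousAt_fst (p := ((0 : Fin n → ℂ), (0 : Fin e → ℂ)))).eventually
        (p := fun z => ∀ i, ‖z i‖ ≤ r ^ 2) (eventually_polydisc (pow_pos hr.pos 2))
    have hsnd : ∀ᶠ p in 𝓝 ((0 : Fin n → ℂ), (0 : Fin e → ℂ)), ∀ i, ‖p.2 i‖ ≤ r ^ 2 :=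
      (continuousAt_snd (p := ((0 : Fin n → ℂ), (0 : Fin e → ℂ)))).eventually
        (p := fun z => ∀ i, ‖z i‖ ≤ r ^ 2) (eventually_polydisc (pow_pos hr.pos 2))
    have hsnd' := (continuousAt_snd (p := ((0 : Fin n → ℂ), (0 : Fin e → ℂ)))).eventually hy
    filter_upwards [hfst, hsnd, hsnd'] with p hp1 hp2 hp3
    have h1 := (hdiag.slice hp2).hasSum p.1 hp1
    convert! h1 using 2 with α
    rw [sliceSeries_diagonalSeries, hp3]
    rfl

end Local

end Quotient

/-! ### Polynomial dependence on jets and on the inverse Jacobian determinant. -/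

noncomputable section JetAlgebra

section Subalgebra

variable {X : Type*} (S : Subalgebra ℂ (X → ℂ))

theorem Subalgebra.const_fun_mem (w : ℂ) : (fun _ : X => w) ∈ S :=
  S.algebraMap_mem w

theorem Subalgebra.mul_fun_mem {f g : X → ℂ} (hf : f ∈ S) (hg : g ∈ S) :
    (fun x => f x * g x) ∈ S :=
  S.mul_mem hf hg

theorem Subalgebra.prod_fun_mem {γ : Type*} (t : Finset γ)
    (F : γ → X → ℂ) (h : ∀ k ∈ t, F k ∈ S) : (fun x => ∏ k ∈ t, F k x) ∈ S := by
  have := S.prod_mem h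
  convert this using 2 with x
  simp

variable {ι : Type*} [Fintype ι] [DecidableEq ι] {M : X → Matrix ι ι ℂ}

theorem Subalgebra.matrix_det_mem (h : ∀ i j, (fun x => M x i j) ∈ S) :
    (fun x => (M x).det) ∈ S := by
  simp only [Matrix.det_apply']
  exact S.sum_fun_mem _ _ fun σ _ => S.mul_fun_mem (S.const_fun_mem _)
    (S.prod_fun_mem _ _ fun i _ => h _ _)

theorem Subalgebra.matrix_adjugate_mem (h : ∀ i j, (fun x => M x i j) ∈ S) (i j : ι) :
    (fun x => (M x).adjugate i j) ∈ S := by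
  simp only [Matrix.adjugate_apply]
  refine S.matrix_det_mem fun k l => ?_
  by_cases hk : k = j
  · subst hk
    simp only [Matrix.updateRow_self]
    exact S.const_fun_mem _
  · simp only [Matrix.updateRow_ne hk]
    exact h k l

theorem Subalgebra.matrix_inv_mulVec_mem (h : ∀ i j, (fun x => M x i j) ∈ S)
    (hdet : (fun x => (M x).det⁻¹) ∈ S) (w : ι → ℂ) (i : ι) :
    (fun x => (M x)⁻¹.mulVec w i) ∈ S := by
  simp only [Matrix.inv_def, Ring.inverse_eq_inv', Matrix.smul_apply, smul_eq_mul,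
    Matrix.mulVec, dotProduct]
  exact S.sum_fun_mem _ _ fun k _ => S.mul_fun_mem (S.mul_fun_mem hdet
    (S.matrix_adjugate_mem h i k)) (S.const_fun_mem _)

end Subalgebra

/-- Coefficients of a quotient of two families of power series. -/
theorem coeff_mul_inv_mem {X ι : Type*} {A : ℕ → Subalgebra ℂ (X → ℂ)} (hA : Monotone A)
    (φ : (ι →₀ ℕ) →+ ℕ) (s : ℕ) {F G : X → MvPowerSeries ι ℂ}
    (hF : ∀ μ, (fun x => MvPowerSeries.coeff μ (F x)) ∈ A (s + φ μ))
    (hG : ∀ μ, (fun x => MvPowerSeries.coeff μ (G x)) ∈ A (s + φ μ)) {w : ℂ} (hw : w ≠ 0)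
    (hG0 : ∀ x, MvPowerSeries.coeff 0 (G x) = w) (μ : ι →₀ ℕ) :
    (fun x => MvPowerSeries.coeff μ (F x * (G x)⁻¹)) ∈ A (s + φ μ) := by
  classical
  induction hk : μ.degree using Nat.strong_induction_on generalizing μ with
  | _ k ih =>
  -- Solve (F G⁻¹)G = F for the coefficient at μ; the only division is by the constant `w`. The
  -- recursion runs on the total degree because φ may vanish on nonzero indices.
  have hrec : ∀ x, MvPowerSeries.coeff μ (F x * (G x)⁻¹) = (MvPowerSeries.coeff μ (F x) -
      ∑ p ∈ (Finset.HasAntidiagonal.antidiagonal μ).erase (μ, 0),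
        MvPowerSeries.coeff p.1 (F x * (G x)⁻¹) * MvPowerSeries.coeff p.2 (G x)) * w⁻¹ := by
    intro x
    have h1 : F x * (G x)⁻¹ * G x = F x := by
      rw [mul_assoc, MvPowerSeries.inv_mul_cancel, mul_one]
      rw [← MvPowerSeries.coeff_zero_eq_constantCoeff_apply, hG0]
      exact hw
    have h2 := congrArg (MvPowerSeries.coeff μ) h1
    rw [MvPowerSeries.coeff_mul, ← Finset.add_sum_erase _ _
      (Finset.HasAntidiagonal.mem_antidiagonal.2 (add_zero μ) :
        (μ, 0) ∈ Finset.HasAntidiagonal.antidiagonal μ), hG0] at h2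
    rw [← h2, add_sub_cancel_right, mul_inv_cancel_right₀ hw]
  simp_rw [hrec]
  refine (A _).mul_const_fun_mem _ ((A _).sub_mem (hF μ) ?_)
  refine (A _).sum_fun_mem _ _ fun p hp => ?_
  obtain ⟨hne, hp⟩ := Finset.mem_erase.1 hp
  have hp' := Finset.HasAntidiagonal.mem_antidiagonal.1 hp
  have hφ : φ p.1 + φ p.2 = φ μ := by rw [← map_add, hp']
  refine (A _).mul_fun_mem (hA (by omega) (ih p.1.degree ?_ p.1 rfl)) (hA (by omega) (hG p.2))
  have h2 : p.2.degree ≠ 0 := by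
    intro h0
    rw [Finsupp.degree_eq_zero_iff] at h0
    exact hne (Prod.ext (by rw [← hp', h0, add_zero]) h0)
  have h3 : p.1.degree + p.2.degree = k := by rw [← map_add, hp', hk]
  omega

variable {n m : ℕ} {X : Type*}

theorem jetCoords_inl {l : ℕ} (f : (Fin n → ℂ) → (Fin m → ℂ)) (g : (Fin n → ℂ) → (Fin n → ℂ))
    (β : {β : Fin n → ℕ // ∑ i, β i ≤ l}) (i : Fin m) :
    jetCoords l f g (β, Sum.inl i) = taylorCoeff β.1 f i :=
  rfl

theorem jetCoords_inr {l : ℕ} (f : (Fin n → ℂ) → (Fin m → ℂ)) (g : (Fin n → ℂ) → (Fin n → ℂ))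
    (β : {β : Fin n → ℕ // ∑ i, β i ≤ l}) (j : Fin n) :
    jetCoords l f g (β, Sum.inr j) = taylorCoeff β.1 g j :=
  rfl

/-- The functions on `X` that are polynomials in the Taylor coefficients of order at most `l` of the
families `b` and `c` and in the inverse of the Jacobian determinant of `c`. -/
def jetAlgebra (b : X → (Fin n → ℂ) → (Fin m → ℂ)) (c : X → (Fin n → ℂ) → (Fin n → ℂ)) (l : ℕ) :
    Subalgebra ℂ (X → ℂ) :=
  Algebra.adjoin ℂ (insert (fun x => (fderiv ℂ (c x) 0).det⁻¹)
    (Set.range fun (v : JetVar n m l) x => jetCoords l (b x) (c x) v))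

variable {b : X → (Fin n → ℂ) → (Fin m → ℂ)} {c : X → (Fin n → ℂ) → (Fin n → ℂ)}

theorem jetAlgebra_mono : Monotone (jetAlgebra b c) := by
  intro l l' hl
  refine Algebra.adjoin_mono (Set.insert_subset_insert ?_)
  rintro _ ⟨⟨β, i | j⟩, rfl⟩
  · exact ⟨(⟨β.1, β.2.trans hl⟩, Sum.inl i), rfl⟩
  · exact ⟨(⟨β.1, β.2.trans hl⟩, Sum.inr j), rfl⟩

theorem inv_det_mem_jetAlgebra (l : ℕ) :
    (fun x => (fderiv ℂ (c x) 0).det⁻¹) ∈ jetAlgebra b c l :=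
  Algebra.subset_adjoin (Set.mem_insert _ _)

theorem sum_coe_eq_degree {ι : Type*} [Fintype ι] (ν : ι →₀ ℕ) : ∑ i, ν i = ν.degree :=
  (Finsupp.degree_eq_sum ν).symm

theorem coeff_fst_mem_jetAlgebra (hb : ∀ x, AnalyticAt ℂ (b x) 0) {l : ℕ} {ν : Fin n →₀ ℕ}
    (hν : ν.degree ≤ l) (i : Fin m) :
    (fun x => MvPowerSeries.coeff ν (taylorSeries fun z => b x z i)) ∈ jetAlgebra b c l := by
  refine Algebra.subset_adjoin (Set.mem_insert_of_mem _
    ⟨(⟨ν, (sum_coe_eq_degree ν).trans_le hν⟩, Sum.inl i), ?_⟩)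
  funext x
  beta_reduce
  rw [jetCoords_inl, taylorCoeff_apply (hb x)]
  simp

theorem coeff_snd_mem_jetAlgebra (hc : ∀ x, AnalyticAt ℂ (c x) 0) {l : ℕ} {ν : Fin n →₀ ℕ}
    (hν : ν.degree ≤ l) (j : Fin n) :
    (fun x => MvPowerSeries.coeff ν (taylorSeries fun z => c x z j)) ∈ jetAlgebra b c l := by
  refine Algebra.subset_adjoin (Set.mem_insert_of_mem _
    ⟨(⟨ν, (sum_coe_eq_degree ν).trans_le hν⟩, Sum.inr j), ?_⟩)
  funext x
  beta_reduce
  rw [jetCoords_inr, taylorCoeff_apply (hc x)]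
  simp

theorem jacobianMatrix_apply {c : (Fin n → ℂ) → (Fin n → ℂ)} (hc : AnalyticAt ℂ c 0)
    (j i : Fin n) : jacobianMatrix c j i =
      MvPowerSeries.coeff (Finsupp.single i 1) (taylorSeries fun z => c z j) := by
  have hcj := analyticAt_pi_iff.1 hc j
  have h := MvPowerSeries.coeff_pderiv (i := i) (taylorSeries fun z => c z j) 0
  rw [← taylorSeries_coordDeriv hcj, coeff_zero_taylorSeries (hcj.coordDeriv i),
    coordDeriv_apply_zero hc, zero_add] at h
  simpa using h

theorem exists_polynomial_eval_jetCoords_eq_det (hc : ∀ x, AnalyticAt ℂ (c x) 0) {l : ℕ}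
    (hl : 1 ≤ l) : ∃ D : MvPolynomial (JetVar n m l) ℂ, ∀ x,
      MvPolynomial.eval (jetCoords l (b x) (c x)) D = (fderiv ℂ (c x) 0).det := by
  refine ⟨(Matrix.of fun j i : Fin n =>
    (MvPolynomial.X (⟨(Finsupp.single i 1 : Fin n →₀ ℕ), by
      rw [sum_coe_eq_degree, Finsupp.degree_single]; exact hl⟩, Sum.inr j) :
      MvPolynomial (JetVar n m l) ℂ)).det, fun x => ?_⟩
  rw [← det_jacobianMatrix, RingHom.map_det]
  congr 1
  ext j i
  rw [jacobianMatrix_apply (hc x), RingHom.mapMatrix_apply, Matrix.map_apply, Matrix.of_apply,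
    MvPolynomial.eval_X, jetCoords_inr, taylorCoeff_apply (hc x)]
  simp

/-- Elements of the jet algebra have a polynomial numerator over every sufficiently high power of
the Jacobian determinant. -/
theorem exists_polynomial_of_mem_jetAlgebra (hc : ∀ x, AnalyticAt ℂ (c x) 0)
    (hdet : ∀ x, (fderiv ℂ (c x) 0).det ≠ 0) {l : ℕ} (hl : 1 ≤ l) {q : X → ℂ}
    (hq : q ∈ jetAlgebra b c l) :
    ∃ k₀ : ℕ, ∀ k, k₀ ≤ k → ∃ p : MvPolynomial (JetVar n m l) ℂ, ∀ x,
      q x = MvPolynomial.eval (jetCoords l (b x) (c x)) p / (fderiv ℂ (c x) 0).det ^ k := by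
  obtain ⟨D, hD⟩ := exists_polynomial_eval_jetCoords_eq_det (m := m) (b := b) hc hl
  suffices h : ∃ (k : ℕ) (p : MvPolynomial (JetVar n m l) ℂ), ∀ x,
      q x = MvPolynomial.eval (jetCoords l (b x) (c x)) p / (fderiv ℂ (c x) 0).det ^ k by
    obtain ⟨k₀, p, hp⟩ := h
    -- Expanding the fraction by the determinant, itself polynomial in the jets, reaches any larger
    -- exponent; this gives the components of p_α a common one.
    refine ⟨k₀, fun k hk => ⟨p * D ^ (k - k₀), fun x => ?_⟩⟩
    obtain ⟨i, rfl⟩ := Nat.exists_eq_add_of_le hk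
    rw [hp, map_mul, map_pow, hD, Nat.add_sub_cancel_left, pow_add,
      mul_div_mul_right _ _ (pow_ne_zero i (hdet x))]
  induction hq using Algebra.adjoin_induction with
  | mem q hq =>
    rcases hq with rfl | ⟨v, rfl⟩
    · exact ⟨1, 1, fun x => by simp⟩
    · exact ⟨0, MvPolynomial.X v, fun x => by simp⟩
  | algebraMap r => exact ⟨0, MvPolynomial.C r, fun x => by simp⟩
  | add q q' _ _ h h' =>
    obtain ⟨k, p, hp⟩ := h
    obtain ⟨k', p', hp'⟩ := h'
    refine ⟨k + k', p * D ^ k' + p' * D ^ k, fun x => ?_⟩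
    have := hdet x
    simp only [Pi.add_apply, hp, hp', map_add, map_mul, map_pow, hD]
    field_simp
    ring
  | mul q q' _ _ h h' =>
    obtain ⟨k, p, hp⟩ := h
    obtain ⟨k', p', hp'⟩ := h'
    refine ⟨k + k', p * p', fun x => ?_⟩
    simp only [Pi.mul_apply, hp, hp', map_mul, pow_add]
    rw [div_mul_div_comm]

theorem coeff_comp_mem_jetAlgebra (hc : ∀ x, AnalyticAt ℂ (c x) 0) (hc0 : ∀ x, c x 0 = 0)
    {θ : (Fin n → ℂ) → ℂ} (hθ : AnalyticAt ℂ θ 0)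
    (μ : Fin n →₀ ℕ) :
    (fun x => MvPowerSeries.coeff μ (taylorSeries fun z => θ (c x z))) ∈
      jetAlgebra b c (μ.degree + 1) := by
  have := coeff_taylorSeries_comp_mem (A := fun l => jetAlgebra b c (l + 1))
    (fun l l' h => jetAlgebra_mono (by omega)) Finsupp.degree (C := c)
    (fun x => analyticAt_pi_iff.1 (hc x)) hc0
    (fun j μ => coeff_snd_mem_jetAlgebra hc (Nat.le_succ _) j)
    (fun j μ hμ x => ?_) μ 0 (fun _ => θ) (fun _ => hθ) fun ν => Subalgebra.const_fun_mem _ _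
  · rwa [zero_add] at this
  · rw [Finsupp.degree_eq_zero_iff] at hμ
    rw [hμ, coeff_zero_taylorSeries (analyticAt_pi_iff.1 (hc x) j), hc0]
    rfl

theorem pullbackDirection_mem_jetAlgebra (hc : ∀ x, AnalyticAt ℂ (c x) 0) (w : Fin n → ℂ)
    (j : Fin n) {l : ℕ} (hl : 1 ≤ l) :
    (fun x => pullbackDirection (c x) w j) ∈ jetAlgebra b c l := by
  refine Subalgebra.matrix_inv_mulVec_mem (M := fun x => jacobianMatrix (c x)) _
    (fun j i => ?_) ?_ w j
  · simp only [fun x => jacobianMatrix_apply (hc x) j i]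
    exact coeff_snd_mem_jetAlgebra hc (by rwa [Finsupp.degree_single]) j
  · simp only [det_jacobianMatrix]
    exact inv_det_mem_jetAlgebra l

/-- Weight by the ζ-degree alone: every monomial of a ray component contains ζ, so powers of σ cost
nothing. The extra 1 makes the Jacobian, and hence v, available at every level. -/
theorem coeff_comp_rayMap_mem_jetAlgebra (hc : ∀ x, AnalyticAt ℂ (c x) 0) (w : Fin n → ℂ)
    {f : X → (Fin n → ℂ) → ℂ} (hf : ∀ x, AnalyticAt ℂ (f x) 0)
    (hfA : ∀ ν, (fun x => MvPowerSeries.coeff ν (taylorSeries (f x))) ∈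
      jetAlgebra b c (ν.degree + 1)) (μ : Option (Fin n) →₀ ℕ) :
    (fun x => MvPowerSeries.coeff μ
      (taylorSeries fun z => f x (rayMap (pullbackDirection (c x) w) z))) ∈
      jetAlgebra b c (μ none + 1) := by
  have := coeff_taylorSeries_comp_mem (A := fun l => jetAlgebra b c (l + 1))
    (fun l l' h => jetAlgebra_mono (by omega)) (Finsupp.applyAddHom none)
    (C := fun x => rayMap (pullbackDirection (c x) w))
    (fun x j => (representedBy_rayMap _ j).analyticAt) (fun x => rayMap_zero _)
    (fun j μ => ?_)
    (fun j μ hμ x => coeff_taylorSeries_rayMap_eq_zero _ j hμ) μ 0 f hf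
    (fun ν => by rw [zero_add]; exact hfA ν)
  · rwa [zero_add] at this
  · classical
    simp only [fun x => (representedBy_rayMap (pullbackDirection (c x) w) j).taylorSeries_eq]
    rw [MvPowerSeries.X]
    simp only [MvPowerSeries.coeff_monomial_mul, map_add, MvPowerSeries.coeff_C, one_mul]
    split_ifs with h1 h2
    · exact Subalgebra.add_mem _ (pullbackDirection_mem_jetAlgebra hc w j (by omega))
        (Subalgebra.const_fun_mem _ _)
    · exact Subalgebra.const_fun_mem _ _
    · exact Subalgebra.const_fun_mem _ _

/-- The Taylor coefficients of the quotients are polynomials in the jets and in the inverse of the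
Jacobian determinant. -/
theorem quotientCoeff_mem_jetAlgebra (hb : ∀ x, AnalyticAt ℂ (b x) 0)
    (hc : ∀ x, AnalyticAt ℂ (c x) 0) (hc0 : ∀ x, c x 0 = 0)
    {Δ : (Fin n → ℂ) → ℂ} {d : ℕ} {w : Fin n → ℂ}
    (hΔ : AnalyticAt ℂ Δ 0)
    (hd : ∀ ν : Fin n →₀ ℕ, ν.degree < d → MvPowerSeries.coeff ν (taylorSeries Δ) = 0)
    (hw : homogeneousValue (taylorSeries Δ) d w ≠ 0)
    (hdet : ∀ x, (fderiv ℂ (c x) 0).det ≠ 0) {θ : Fin m → (Fin n → ℂ) → ℂ}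
    (hθ : ∀ k, AnalyticAt ℂ (θ k) 0) (α : Fin n →₀ ℕ) :
    (fun x => quotientCoeff Δ d w (c x) (fun z => ∑ k, θ k (c x z) * b x z k) α) ∈
      jetAlgebra b c (2 * d + 1 + α.degree) := by
  have hθc : ∀ k x, AnalyticAt ℂ (fun z => θ k (c x z)) 0 := fun k x =>
    (hθ k).fun_comp_of_eq (hc x) (hc0 x)
  have hbk : ∀ k x, AnalyticAt ℂ (fun z => b x z k) 0 := fun k x => analyticAt_pi_iff.1 (hb x) k
  have hf : ∀ x, AnalyticAt ℂ (fun z => ∑ k, θ k (c x z) * b x z k) 0 := fun x =>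
    Finset.analyticAt_fun_sum _ fun k _ => (hθc k x).mul (hbk k x)
  have hnum := coeff_comp_rayMap_mem_jetAlgebra (b := b) hc w hf fun ν => by
    simp only [fun x => taylorSeries_sum Finset.univ (fun k z => θ k (c x z) * b x z k)
      fun k => (hθc k x).mul (hbk k x), map_sum]
    refine Subalgebra.sum_fun_mem _ _ _ fun k _ => ?_
    classical
    simp only [fun x => taylorSeries_mul (hθc k x) (hbk k x), MvPowerSeries.coeff_mul]
    refine Subalgebra.sum_fun_mem _ _ _ fun p hp => ?_
    have hp' : p.1.degree + p.2.degree = ν.degree := by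
      rw [← map_add, Finset.HasAntidiagonal.mem_antidiagonal.1 hp]
    exact Subalgebra.mul_fun_mem _
      (jetAlgebra_mono (by omega) (coeff_comp_mem_jetAlgebra hc hc0 (hθ k) p.1))
      (coeff_fst_mem_jetAlgebra hb (by omega) k)
  have hden := coeff_comp_rayMap_mem_jetAlgebra (b := b) hc w
    (fun x => hΔ.fun_comp_of_eq (hc x) (hc0 x)) (coeff_comp_mem_jetAlgebra hc hc0 hΔ)
  -- The offset `d` accounts for the ζ^d removed from the denominator. At ζ-degree d + |α| the level
  -- is d + (d + |α|) + 1.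
  have := coeff_mul_inv_mem (A := fun l => jetAlgebra b c (l + 1))
    (fun l l' h => jetAlgebra_mono (by omega)) (Finsupp.applyAddHom none) d
    (F := fun x => numeratorSeries w (c x) fun z => ∑ k, θ k (c x z) * b x z k)
    (G := fun x => denominatorSeries Δ d w (c x))
    (fun μ => jetAlgebra_mono (by simp) (hnum μ))
    (fun μ => ?_) hw
    (fun x => coeff_zero_denominatorSeries hΔ hd (hc x) (hc0 x)
      (by rw [det_jacobianMatrix]; exact hdet x)) (optionIndex (d + α.degree) α)
  · refine jetAlgebra_mono ?_ this
    simp only [Finsupp.applyAddHom_apply, optionIndex_none]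
    omega
  · refine jetAlgebra_mono ?_ (hden (μ + Finsupp.single none d))
    simp
    omega

end JetAlgebra

/-! ### Centred coordinates on the manifold. -/

noncomputable section ChartCoordinates

theorem Matrix.det_ne_zero_of_rank_eq {m : ℕ} {M : Matrix (Fin m) (Fin m) ℂ} (h : M.rank = m) :
    M.det ≠ 0 := by
  intro hdet
  obtain ⟨v, hv, hMv⟩ := Matrix.exists_mulVec_eq_zero_iff.2 hdet
  have hr : LinearMap.range M.mulVecLin = ⊤ := by
    apply Submodule.eq_top_of_finrank_eq
    rw [← Matrix.rank, h, Module.finrank_fin_fun]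
  have hinj := LinearMap.injective_iff_surjective.2 (LinearMap.range_eq_top.1 hr)
  exact hv (hinj (by simpa using hMv))

variable {E : Type*} [NormedAddCommGroup E] [NormedSpace ℂ E] [FiniteDimensional ℂ E]
  {X : Type*} [TopologicalSpace X] [ChartedSpace E X]

variable (E) in
/-- Linear coordinates on a finite-dimensional space. -/
def linearCoords : E ≃L[ℂ] (Fin (Module.finrank ℂ E) → ℂ) :=
  (Module.finBasis ℂ E).equivFunL

/-- Linear coordinates on a complex manifold that are centred at `x₀`. -/
def centredCoords (x₀ x : X) : Fin (Module.finrank ℂ E) → ℂ :=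
  linearCoords E (extChartAt 𝓘(ℂ, E) x₀ x - extChartAt 𝓘(ℂ, E) x₀ x₀)

variable (E) in
/-- The local parametrization that is inverse to `centredCoords`. -/
def centredParam (x₀ : X) (y : Fin (Module.finrank ℂ E) → ℂ) : X :=
  (extChartAt 𝓘(ℂ, E) x₀).symm ((linearCoords E).symm y + extChartAt 𝓘(ℂ, E) x₀ x₀)

theorem centredCoords_self (x₀ : X) : centredCoords (E := E) x₀ x₀ = 0 := by
  simp [centredCoords]

theorem centredParam_zero (x₀ : X) : centredParam E x₀ 0 = x₀ := by
  simp [centredParam]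

theorem centredParam_centredCoords {x₀ x : X} (hx : x ∈ (chartAt E x₀).source) :
    centredParam E x₀ (centredCoords x₀ x) = x := by
  rw [centredParam, centredCoords, ContinuousLinearEquiv.symm_apply_apply, sub_add_cancel]
  exact (extChartAt 𝓘(ℂ, E) x₀).left_inv (by rwa [extChartAt_source])

variable [IsManifold 𝓘(ℂ, E) ω X]

theorem contMDiffAt_centredCoords {x₀ x : X} (hx : x ∈ (chartAt E x₀).source) :
    ContMDiffAt 𝓘(ℂ, E) 𝓘(ℂ, Fin (Module.finrank ℂ E) → ℂ) ω (centredCoords (E := E) x₀) x := by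
  have h1 : ContMDiffAt 𝓘(ℂ, E) 𝓘(ℂ, E) ω (extChartAt 𝓘(ℂ, E) x₀) x := contMDiffAt_extChartAt' hx
  have h2 : ContDiff ℂ ω fun y : E => linearCoords E (y - extChartAt 𝓘(ℂ, E) x₀ x₀) :=
    (linearCoords E).contDiff.comp (contDiff_id.sub contDiff_const)
  exact h2.contMDiff.contMDiffAt.comp x h1

theorem contMDiffAt_centredParam (x₀ : X) :
    ContMDiffAt 𝓘(ℂ, Fin (Module.finrank ℂ E) → ℂ) 𝓘(ℂ, E) ω (centredParam E x₀) 0 := by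
  have h1 : ContMDiffAt 𝓘(ℂ, E) 𝓘(ℂ, E) ω (extChartAt 𝓘(ℂ, E) x₀).symm
      (extChartAt 𝓘(ℂ, E) x₀ x₀) :=
    (contMDiffOn_extChartAt_symm x₀).contMDiffAt (extChartAt_target_mem_nhds x₀)
  have h2 : ContDiff ℂ ω fun y : Fin (Module.finrank ℂ E) → ℂ =>
      (linearCoords E).symm y + extChartAt 𝓘(ℂ, E) x₀ x₀ :=
    (linearCoords E).symm.contDiff.add contDiff_const
  refine ContMDiffAt.comp_of_eq (f := fun y : Fin (Module.finrank ℂ E) → ℂ =>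
      (linearCoords E).symm y + extChartAt 𝓘(ℂ, E) x₀ x₀) h1 h2.contMDiff.contMDiffAt ?_
  simp

/-- A holomorphic map on a product with a manifold is analytic in local coordinates. -/
theorem analyticAt_comp_centredParam {n k : ℕ} {F : (Fin n → ℂ) × X → (Fin k → ℂ)} {x₀ : X}
    (hF : ContMDiffAt (𝓘(ℂ, Fin n → ℂ).prod 𝓘(ℂ, E)) 𝓘(ℂ, Fin k → ℂ) ω F (0, x₀)) :
    AnalyticAt ℂ (fun p : (Fin n → ℂ) × (Fin (Module.finrank ℂ E) → ℂ) =>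
      F (p.1, centredParam E x₀ p.2)) (0, 0) := by
  have h1 : ContMDiffAt 𝓘(ℂ, (Fin n → ℂ) × (Fin (Module.finrank ℂ E) → ℂ))
      (𝓘(ℂ, Fin n → ℂ).prod 𝓘(ℂ, E)) ω
      (fun p : (Fin n → ℂ) × (Fin (Module.finrank ℂ E) → ℂ) => (p.1, centredParam E x₀ p.2))
      ((0 : Fin n → ℂ), (0 : Fin (Module.finrank ℂ E) → ℂ)) := by
    refine ContMDiffAt.prodMk contDiff_fst.contMDiff.contMDiffAt ?_
    exact (contMDiffAt_centredParam x₀).comp_of_eq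
      (f := fun p : (Fin n → ℂ) × (Fin (Module.finrank ℂ E) → ℂ) => p.2)
      contDiff_snd.contMDiff.contMDiffAt rfl
  have h2 := ContMDiffAt.comp_of_eq (g := F)
    (f := fun p : (Fin n → ℂ) × (Fin (Module.finrank ℂ E) → ℂ) =>
      (p.1, centredParam E x₀ p.2)) hF h1 (by simp only [centredParam_zero])
  have h3 := contMDiffAt_iff_contDiffAt.1 h2
  exact h3.analyticAt

/-- A map that is analytic in local coordinates is holomorphic. -/
theorem contMDiffAt_comp_centredCoords {n k : ℕ}
    {g : (Fin n → ℂ) × (Fin (Module.finrank ℂ E) → ℂ) → (Fin k → ℂ)} {x₀ : X}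
    {q : (Fin n → ℂ) × X} (hq : q.2 ∈ (chartAt E x₀).source)
    (hg : AnalyticAt ℂ g (q.1, centredCoords x₀ q.2)) :
    ContMDiffAt (𝓘(ℂ, Fin n → ℂ).prod 𝓘(ℂ, E)) 𝓘(ℂ, Fin k → ℂ) ω
      (fun q => g (q.1, centredCoords x₀ q.2)) q := by
  have h1 : ContMDiffAt (𝓘(ℂ, Fin n → ℂ).prod 𝓘(ℂ, E))
      𝓘(ℂ, (Fin n → ℂ) × (Fin (Module.finrank ℂ E) → ℂ)) ω
      (fun q : (Fin n → ℂ) × X => (q.1, centredCoords (E := E) x₀ q.2)) q :=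
    ContMDiffAt.prodMk_space contMDiffAt_fst
      ((contMDiffAt_centredCoords hq).comp q contMDiffAt_snd)
  exact ContMDiffAt.comp (g := g) q hg.contDiffAt.contMDiffAt h1

end ChartCoordinates

/-! ### The division theorem with parameters in a manifold. -/

theorem proposition5p3 {m n : ℕ} (hm : 1 ≤ m) (hn : 1 ≤ n)
    -- the germ at the origin of an `m × m` holomorphic matrix of generic rank `m`
    (Θ : (Fin n → ℂ) → Matrix (Fin m) (Fin m) ℂ)
    (hΘ : ∀ i j, AnalyticAt ℂ (fun z => Θ z i j) 0)
    (hrank : HasGenericRank Θ m)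
    -- a complex manifold `X`
    {E : Type*} [NormedAddCommGroup E] [NormedSpace ℂ E] [FiniteDimensional ℂ E]
    {X : Type*} [TopologicalSpace X] [ChartedSpace E X] [IsManifold 𝓘(ℂ, E) ω X]
    -- holomorphic maps `c` and `b` defined on an open neighbourhood `V` of `{0} × X`
    (V : Set ((Fin n → ℂ) × X)) (hV : IsOpen V) (hV0 : ∀ x : X, (0, x) ∈ V)
    (c : (Fin n → ℂ) × X → (Fin n → ℂ))
    (hc : ContMDiffOn (𝓘(ℂ, Fin n → ℂ).prod 𝓘(ℂ, E)) 𝓘(ℂ, Fin n → ℂ) ω c V)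
    (b : (Fin n → ℂ) × X → (Fin m → ℂ))
    (hb : ContMDiffOn (𝓘(ℂ, Fin n → ℂ).prod 𝓘(ℂ, E)) 𝓘(ℂ, Fin m → ℂ) ω b V)
    (hc0 : ∀ x : X, c (0, x) = 0)
    (hcz : ∀ x : X, (fderiv ℂ (fun z => c (z, x)) 0).det ≠ 0) :
    ∃ (W : Set ((Fin n → ℂ) × X)) (Γ : (Fin n → ℂ) × X → (Fin m → ℂ)),
      IsOpen W ∧ (∀ x : X, (0, x) ∈ W) ∧
      ContMDiffOn (𝓘(ℂ, Fin n → ℂ).prod 𝓘(ℂ, E)) 𝓘(ℂ, Fin m → ℂ) ω Γ W ∧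
      (∀ (x₀ : X) (u : (Fin n → ℂ) → (Fin m → ℂ)), AnalyticAt ℂ u 0 →
        (∀ᶠ z in 𝓝 0, (Θ (c (z, x₀))).mulVec (u z) = b (z, x₀)) →
        ∀ᶠ z in 𝓝 0, u z = Γ (z, x₀)) ∧
      ∃ (l₀ : ℕ) (k : (Fin n → ℕ) → ℕ)
        (p : (α : Fin n → ℕ) → Fin m → MvPolynomial (JetVar n m (l₀ + ∑ i, α i)) ℂ),
        ∀ (z : Fin n → ℂ) (x : X), (z, x) ∈ W →
          HasSum (fun α : Fin n → ℕ => (∏ i, z i ^ α i) • fun j : Fin m =>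
              MvPolynomial.eval
                  (jetCoords (l₀ + ∑ i, α i) (fun ζ => b (ζ, x)) (fun ζ => c (ζ, x))) (p α j)
                / (fderiv ℂ (fun ζ => c (ζ, x)) 0).det ^ k α)
            (Γ (z, x)) := by
  -- the leading form of the determinant
  have hΔ : AnalyticAt ℂ (fun z => (Θ z).det) 0 := AnalyticAt.matrix_det hΘ
  have hΔ0 : taylorSeries (fun z => (Θ z).det) ≠ 0 := by
    intro h
    have h1 := hΔ.representedBy
    rw [h] at h1
    refine hrank.2 ?_
    filter_upwards [h1.eventuallyEq representedBy_zero] with z hz hr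
    exact Matrix.det_ne_zero_of_rank_eq hr hz
  obtain ⟨d, w, hd, hw⟩ := exists_homogeneousValue_ne_zero hΔ0
  set Δ : (Fin n → ℂ) → ℂ := fun z => (Θ z).det with hΔdef
  let θ : Fin m → Fin m → (Fin n → ℂ) → ℂ := fun j k z => (Θ z).adjugate j k
  have hθ : ∀ j k, AnalyticAt ℂ (θ j k) 0 := fun j k => AnalyticAt.matrix_adjugate hΘ j k
  let f : Fin m → (Fin n → ℂ) × X → ℂ := fun j q => ∑ k, θ j k (c q) * b q k
  -- analyticity in local coordinates
  have hVn : ∀ x : X, V ∈ 𝓝 ((0 : Fin n → ℂ), x) := fun x => hV.mem_nhds (hV0 x)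
  have hcloc := fun x : X => analyticAt_comp_centredParam (hc.contMDiffAt (hVn x))
  have hbloc := fun x : X => analyticAt_comp_centredParam (hb.contMDiffAt (hVn x))
  have hslice : AnalyticAt ℂ (fun z : Fin n → ℂ =>
      (z, (0 : Fin (Module.finrank ℂ E) → ℂ))) 0 := analyticAt_id.prod analyticAt_const
  have hcx : ∀ x : X, AnalyticAt ℂ (fun z => c (z, x)) 0 := fun x => by
    have := (hcloc x).fun_comp_of_eq hslice rfl
    simpa only [centredParam_zero] using this
  have hbx : ∀ x : X, AnalyticAt ℂ (fun z => b (z, x)) 0 := fun x => by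
    have := (hbloc x).fun_comp_of_eq hslice rfl
    simpa only [centredParam_zero] using this
  have hjac : ∀ x : X, (jacobianMatrix fun z => c (z, x)).det ≠ 0 := fun x => by
    rw [det_jacobianMatrix]; exact hcz x
  let Q : Fin m → (Fin n →₀ ℕ) → X → ℂ := fun j α x =>
    quotientCoeff Δ d w (fun z => c (z, x)) (fun z => f j (z, x)) α
  -- One formula on the whole product, with value 0 where the series diverges. No gluing is needed:
  -- each local holomorphic sum agrees with it near its base point.
  let Γ : (Fin n → ℂ) × X → (Fin m → ℂ) := fun q j =>
    ∑' α : Fin n →₀ ℕ, Q j α q.2 * ∏ i, q.1 i ^ α i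
  have hlocal : ∀ x₀ : X, ∀ᶠ q in 𝓝 ((0 : Fin n → ℂ), x₀),
      (∀ j, HasSum (fun α : Fin n →₀ ℕ => Q j α q.2 * ∏ i, q.1 i ^ α i) (Γ q j)) ∧
      ContMDiffAt (𝓘(ℂ, Fin n → ℂ).prod 𝓘(ℂ, E)) 𝓘(ℂ, Fin m → ℂ) ω Γ q := by
    intro x₀
    have hfloc : ∀ j, AnalyticAt ℂ (fun p : (Fin n → ℂ) × (Fin (Module.finrank ℂ E) → ℂ) =>
        f j (p.1, centredParam E x₀ p.2)) (0, 0) := fun j =>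
      Finset.analyticAt_fun_sum _ fun k _ =>
        ((hθ j k).fun_comp_of_eq (hcloc x₀) (hc0 _)).mul (analyticAt_pi_iff.1 (hbloc x₀) k)
    have hex := fun j => exists_analyticAt_hasSum_quotientCoeff hΔ hd hw (hcloc x₀)
      (Eventually.of_forall fun y => hc0 _)
      (by simpa only [centredParam_zero] using hjac x₀) (hfloc j)
    choose g hg hgsum using hex
    have hga : AnalyticAt ℂ (fun p j => g j p) (0, 0) := analyticAt_pi_iff.2 hg
    have hT : ContinuousAt (fun q : (Fin n → ℂ) × X => (q.1, centredCoords (E := E) x₀ q.2))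
        (0, x₀) := by
      have hcc : ContinuousAt (centredCoords (E := E) x₀) x₀ :=
        (contMDiffAt_centredCoords (mem_chart_source E x₀)).continuousAt
      exact continuousAt_fst.prodMk (ContinuousAt.comp (g := centredCoords (E := E) x₀)
        (f := Prod.snd) (x := ((0 : Fin n → ℂ), x₀)) hcc continuousAt_snd)
    have hT0 : Tendsto (fun q : (Fin n → ℂ) × X => (q.1, centredCoords (E := E) x₀ q.2))
        (𝓝 (0, x₀)) (𝓝 (0, 0)) := by
      have := hT.tendsto
      rwa [centredCoords_self] at this
    have hsrc : ∀ᶠ q in 𝓝 ((0 : Fin n → ℂ), x₀), q.2 ∈ (chartAt E x₀).source :=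
      continuousAt_snd.eventually ((chartAt E x₀).open_source.mem_nhds (mem_chart_source E x₀))
    have hsum : ∀ᶠ q in 𝓝 ((0 : Fin n → ℂ), x₀), ∀ j,
        HasSum (fun α : Fin n →₀ ℕ => Q j α q.2 * ∏ i, q.1 i ^ α i)
          (g j (q.1, centredCoords x₀ q.2)) := by
      filter_upwards [hT0.eventually (eventually_all.2 hgsum), hsrc] with q hq hq2 j
      have := hq j
      simpa only [centredParam_centredCoords hq2] using this
    filter_upwards [hsum, hsum.eventually_nhds, hT0.eventually hga.eventually_analyticAt, hsrc]
      with q h1 h2 h3 h4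
    refine ⟨fun j => (h1 j).summable.hasSum, ?_⟩
    refine (contMDiffAt_comp_centredCoords h4 h3).congr_of_eventuallyEq ?_
    filter_upwards [h2] with q' hq'
    funext j
    exact (hq' j).tsum_eq
  -- W consists of the points near which the series converges to Γ and Γ is holomorphic, so it is
  -- open by construction.
  refine ⟨{q | ∀ᶠ q' in 𝓝 q,
      (∀ j, HasSum (fun α : Fin n →₀ ℕ => Q j α q'.2 * ∏ i, q'.1 i ^ α i) (Γ q' j)) ∧
      ContMDiffAt (𝓘(ℂ, Fin n → ℂ).prod 𝓘(ℂ, E)) 𝓘(ℂ, Fin m → ℂ) ω Γ q'}, Γ,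
    isOpen_setOfPred_eventually_nhds, ?_, ?_, ?_, ?_⟩
  · intro x₀
    rw [Set.mem_ofPred_eq]
    exact hlocal x₀
  · intro q hq
    rw [Set.mem_ofPred_eq] at hq
    exact hq.self_of_nhds.2.contMDiffWithinAt
  · intro x₀ u hu heq
    have huj := analyticAt_pi_iff.1 hu
    have hdiv : ∀ j, ∀ᶠ z in 𝓝 (0 : Fin n → ℂ), Δ (c (z, x₀)) * u z j = f j (z, x₀) := by
      intro j
      filter_upwards [heq] with z hz
      -- Multiplication by the adjugate decouples the system into scalar equations with common
      -- divisor Δ∘c.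
      have h1 := congrFun (congrArg (Θ (c (z, x₀))).adjugate.mulVec hz) j
      rw [Matrix.mulVec_mulVec, Matrix.adjugate_mul, Matrix.smul_mulVec, Matrix.one_mulVec] at h1
      exact h1
    have hcoef : ∀ j α, MvPowerSeries.coeff α (taylorSeries fun z => u z j) = Q j α x₀ :=
      fun j α => coeff_taylorSeries_eq_quotientCoeff hΔ hd hw (hcx x₀) (hc0 x₀) (hjac x₀) (huj j)
        (hdiv j) α
    have hrep : ∀ j, ∀ᶠ z in 𝓝 (0 : Fin n → ℂ), u z j = Γ (z, x₀) j := by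
      intro j
      obtain ⟨r, hr⟩ := (huj j).representedBy
      filter_upwards [eventually_polydisc hr.pos] with z hz
      have h1 := (hr.hasSum z hz).tsum_eq
      simp only [hcoef] at h1
      exact h1.symm
    filter_upwards [eventually_all.2 hrep] with z hz
    exact funext hz
  · have hmem : ∀ (α : Fin n → ℕ) (j : Fin m),
        Q j (Finsupp.equivFunOnFinite.symm α) ∈ jetAlgebra (fun x z => b (z, x))
          (fun x z => c (z, x)) (2 * d + 1 + ∑ i, α i) := by
      intro α j
      have := quotientCoeff_mem_jetAlgebra (b := fun x z => b (z, x)) (c := fun x z => c (z, x))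
        hbx hcx hc0 hΔ hd hw hcz (hθ j) (Finsupp.equivFunOnFinite.symm α)
      rwa [← sum_coe_eq_degree] at this
    have hpoly := fun α j => exists_polynomial_of_mem_jetAlgebra hcx hcz (by omega) (hmem α j)
    choose k₀ hk₀ using hpoly
    -- The supremum over components gives one exponent k_α for the whole vector p_α.
    choose p hp using fun α j =>
      hk₀ α j (Finset.univ.sup (k₀ α)) (Finset.le_sup (Finset.mem_univ j))
    refine ⟨2 * d + 1, fun α => Finset.univ.sup (k₀ α), p, fun z x hzx => ?_⟩
    rw [Set.mem_ofPred_eq] at hzx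
    rw [Pi.hasSum]
    intro j
    have h1 := Finsupp.equivFunOnFinite.symm.hasSum_iff.2 (hzx.self_of_nhds.1 j)
    convert! h1 using 2 with α
    simp only [Pi.smul_apply, smul_eq_mul, Function.comp_apply]
    rw [hp, mul_comm]
    rfl
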